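/- Let $\mathbb R^5_1$ be $\mathbb R^5$ with $\langle v,w\rangle=-v_1w_1+v_2w_2+\dots+v_5w_5$, let $\mathbb S^4_1=\{\langle x,x\rangle=1\}$ be de Sitter space, $\mathbb H^4=\{\langle x,x\rangle=-1,\ x_1>0\}$, and $B=\{z\in\mathbb C:|z|<1\}$. Let $g:B\to\mathbb S^4_1$ be a branched spacelike stationary surface having $z=0$ as a branch point of order $m\ge1$ and regular everywhere else. That is, $g$ is smooth and weakly conformal ($g^*\langle\,,\rangle=E(dx^2+dy^2)$ with $E\ge 0$ smooth); $dg_z$ is injective for $z\ne0$; the mean curvature vector of $g$ in $\mathbb S^4_1$ vanishes on $B\setminus\{0\}$; and in some smooth chart of $B$ centered at $0$ and some smooth chart of $\mathbb S^4_1$ around $g(0)$ with values in $\mathbb C\times\mathbb R^2$, the map $g$ has the form $\zeta\mapsto(\zeta^{m+1},0)+O(|\zeta|^{m+2})$. Let $T_z$ be the tangent plane of $g$ at $z$: $T_z=dg_z(\mathbb R^2)$ for $z\neq 0$, and $T_0=\lim_{z\to0}T_z$. Let $$\mathcal N_{-1}(g)=\{(z,w)\in B\times\mathbb R^5_1:\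 \langle w,w\rangle=-1,\ w\perp g(z),\ w\perp T_z\}$$ be the timelike unit normal bundle and $\Psi_g(z,w)=w$ the polar map. For $z\ne0$ let $A_w$ be the shape operator of $g$ at $z$ with respect to the normal $w$. Then $\mathcal N_{-1}(g)$ is a smooth embedded $3$-dimensional submanifold of $B\times\mathbb R^5_1$; $\Psi_g$ maps its part $w_1>0$ into $\mathbb H^4$ and the remaining part into the isometric copy $-\mathbb H^4$; and the following hold. a) A point $(z,w)\in\mathcal N_{-1}(g)$ with $z\ne0$ is a regular point of $\Psi_g$ (that is, $d\Psi_g$ is injective there) if and only if $A_w$ is nonsingular. A point $(0,w)\in\mathcal N_{-1}(g)$ is a regular point of $\Psi_g$ if and only if there is a real number $l<0$ such that $$\lim |\zeta|^{2m}\det A_{\omega}=l\qquad\text{as }(\zeta,\omega)\to(0,w)\text{ in }\mathcal N_{-1}(g),\ \zeta\ne0,$$ where $A_\omega$ is taken at $\zeta$. b) On the set of its regular points, $\Psi_g$ is an immersed hypersurface of $\mathbb H^4\cup(-\mathbb H^4)$ with Riemannian induced metric that is minimal (the trace of its shape operator is $0$) and has vanishing Gauss–Kronecker curvature (the determinant of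 its shape operator is $0$). -/

import Mathlib

open Set Filter Topology Asymptotics
open scoped ContDiff

noncomputable section

namespace DeSitterPolar

/-- The underlying space of the Minkowski space `ℝ⁵₁`; its metric is `lorentz`. -/
abbrev R51 : Type := Fin 5 → ℝ

/-- The Lorentzian inner product of signature `(1, 4)`. -/
def lorentz (v w : R51) : ℝ :=
  -(v 0 * w 0) + v 1 * w 1 + v 2 * w 2 + v 3 * w 3 + v 4 * w 4

/-- The de Sitter space `S⁴₁`. -/
def deSitter : Set R51 := {x | lorentz x x = 1}

/-- The hyperbolic space `H⁴`, the upper sheet of `⟨x, x⟩ = -1`. -/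
def hyperbolic : Set R51 := {x | lorentz x x = -1 ∧ 0 < x 0}

/-- The open unit disc `B`. -/
def disc : Set ℂ := Metric.ball 0 1

section Charts

variable {E F G : Type*} [NormedAddCommGroup E] [NormedSpace ℝ E]
  [NormedAddCommGroup F] [NormedSpace ℝ F] [NormedAddCommGroup G] [NormedSpace ℝ G]

/-- `e` is a smooth diffeomorphism from an open set of `E` onto an open set of `F`. -/
def IsSmoothChart (e : OpenPartialHomeomorph E F) : Prop :=
  ContDiffOn ℝ ∞ e e.source ∧ ContDiffOn ℝ ∞ e.symm e.target

/-- `e` is a chart of the ambient space `E` which flattens `S` to `F × {0}`; its first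
component, restricted to `S`, is a chart of the submanifold `S` with values in `F`. -/
def IsSliceChart (S : Set E) (e : OpenPartialHomeomorph E (F × G)) : Prop :=
  IsSmoothChart e ∧ ∀ x ∈ e.source, x ∈ S ↔ (e x).2 = 0

/-- The local parametrization of the submanifold given by a slice chart. -/
def sliceParam (e : OpenPartialHomeomorph E (F × G)) (a : F) : E := e.symm (a, 0)

end Charts

section Forms

variable {V : Type*} [NormedAddCommGroup V] [NormedSpace ℝ V]

/-- The tensor induced by `f` from the Lorentzian inner product. -/
def firstForm (f : V → R51) (a X Y : V) : ℝ :=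
  lorentz (fderiv ℝ f a X) (fderiv ℝ f a Y)

/-- The second fundamental form of `f` at `a` in the direction of the normal vector `ν`. For
maps into the hyperquadric `⟨x, x⟩ = c` and `ν` tangent to it, that is orthogonal to `f a`,
the flat second derivative has the same `ν`-component as the Hessian of the map into the
hyperquadric. -/
def secondForm (f : V → R51) (a : V) (ν : R51) (X Y : V) : ℝ :=
  lorentz (fderiv ℝ (fderiv ℝ f) a X Y) ν

/-- The shape operator `A_ν` of `f` at `a`: the operator with
`firstForm f a (A_ν X) Y = secondForm f a ν X Y`, where the first form is nondegenerate.
It does not depend on the basis `b`. -/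
def shapeOperator {ι : Type*} [Fintype ι] [DecidableEq ι] (b : Module.Basis ι ℝ V)
    (f : V → R51) (a : V) (ν : R51) : V →ₗ[ℝ] V :=
  Matrix.toLin b b
    ((Matrix.of fun i j => firstForm f a (b i) (b j))⁻¹ *
      Matrix.of fun i j => secondForm f a ν (b i) (b j))

end Forms

/-- `z₀` is a branch point of order `m ≥ 1` of the map `g` into `S⁴₁`: in a chart `φ` centered
at `z₀` and a chart of `S⁴₁` around `g z₀` with values in `ℂ × ℝ²`, the map is
`ζ ↦ (ζ ^ (m + 1), 0) + O(|ζ| ^ (m + 2))`. -/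
def IsBranchPoint (g : ℂ → R51) (z₀ : ℂ) (m : ℕ) : Prop :=
  1 ≤ m ∧
  ∃ (φ : OpenPartialHomeomorph ℂ ℂ)
    (ψ : OpenPartialHomeomorph R51 ((ℂ × EuclideanSpace ℝ (Fin 2)) × ℝ)),
    IsSmoothChart φ ∧ z₀ ∈ φ.source ∧ φ z₀ = 0 ∧
    IsSliceChart deSitter ψ ∧ g z₀ ∈ ψ.source ∧
    (fun ζ : ℂ => (ψ (g (φ.symm ζ))).1.1 - ζ ^ (m + 1)) =O[𝓝 0]
      (fun ζ : ℂ => ‖ζ‖ ^ (m + 2)) ∧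
    (fun ζ : ℂ => (ψ (g (φ.symm ζ))).1.2) =O[𝓝 0] (fun ζ : ℂ => ‖ζ‖ ^ (m + 2))

/-- The shape operator `A_w` of the surface `g` at `z` with respect to the normal `w`. -/
def surfaceShape (g : ℂ → R51) (z : ℂ) (w : R51) : ℂ →ₗ[ℝ] ℂ :=
  shapeOperator Complex.basisOneI g z w

/-- `g : B → S⁴₁` is a branched spacelike stationary surface which has a branch point of order
`m` at `0` and is regular elsewhere. Stationary means that the mean curvature vector vanishes:
`trace A_ν = 0` for every vector `ν` tangent to `S⁴₁` and normal to the surface. -/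
structure IsBranchedStationary (g : ℂ → R51) (m : ℕ) : Prop where
  smooth : ContDiffOn ℝ ∞ g disc
  mem_deSitter : ∀ z ∈ disc, g z ∈ deSitter
  conformal : ∃ E : ℂ → ℝ, ContDiffOn ℝ ∞ E disc ∧
    ∀ z ∈ disc, 0 ≤ E z ∧ ∀ X Y : ℂ, firstForm g z X Y = E z * inner ℝ X Y
  branch : IsBranchPoint g 0 m
  regular : ∀ z ∈ disc, z ≠ 0 → Function.Injective (fderiv ℝ g z)
  stationary : ∀ z ∈ disc, z ≠ 0 → ∀ ν : R51, lorentz ν (g z) = 0 →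
    (∀ X : ℂ, lorentz ν (fderiv ℝ g z X) = 0) →
    LinearMap.trace ℝ ℂ (surfaceShape g z ν) = 0

open Classical in
/-- The tangent plane of `g` at `z`: the image of the differential at a regular point, and the
limit of the tangent planes at nearby points (the continuous extension of the Gauss map) at a
branch point. -/
def tangentPlane (g : ℂ → R51) (z : ℂ) : Set R51 :=
  if Function.Injective (fderiv ℝ g z) then range (fderiv ℝ g z)
  else {v | ∃ X : ℂ → ℂ, Tendsto (fun ζ => fderiv ℝ g ζ (X ζ)) (𝓝[≠] z) (𝓝 v)}

/-- The timelike unit normal bundle `N₋₁(g)`, as a subset of `B × ℝ⁵₁`. -/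
def timelikeNormalBundle (g : ℂ → R51) : Set (ℂ × R51) :=
  {p | p.1 ∈ disc ∧ lorentz p.2 p.2 = -1 ∧ lorentz p.2 (g p.1) = 0 ∧
    ∀ v ∈ tangentPlane g p.1, lorentz p.2 v = 0}

/-- The polar map `(z, w) ↦ w`. -/
def polarMap (p : ℂ × R51) : R51 := p.2

/-- Ambient charts of `ℂ × ℝ⁵₁` (of dimension 7) adapted to 3-dimensional submanifolds. -/
abbrev Chart3 : Type := OpenPartialHomeomorph (ℂ × R51) ((Fin 3 → ℝ) × (Fin 4 → ℝ))

/-- `N` is a smooth embedded 3-dimensional submanifold of `ℂ × ℝ⁵₁`. -/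
def IsSubmanifold3 (N : Set (ℂ × R51)) : Prop :=
  ∀ p ∈ N, ∃ e : Chart3, IsSliceChart N e ∧ p ∈ e.source

/-- The expression of the polar map in the local coordinates given by `e`. -/
def polarIn (e : Chart3) (a : Fin 3 → ℝ) : R51 := polarMap (sliceParam e a)

/-- `p` is a regular point of the polar map on `N`: its differential at `p`, computed in a chart
of `N` around `p`, is injective. -/
def IsRegularPoint (N : Set (ℂ × R51)) (p : ℂ × R51) : Prop :=
  p ∈ N ∧ ∃ e : Chart3, IsSliceChart N e ∧ p ∈ e.source ∧
    Function.Injective (fderiv ℝ (polarIn e) (e p).1)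

/-- `ν` is a unit normal at `a` of the hypersurface `f` of the hyperquadric
`⟨x, x⟩ = -1`. -/
def IsUnitNormal (f : (Fin 3 → ℝ) → R51) (a : Fin 3 → ℝ) (ν : R51) : Prop :=
  lorentz ν ν = 1 ∧ lorentz ν (f a) = 0 ∧ ∀ X, lorentz ν (fderiv ℝ f a X) = 0

/-- The hypersurface `f` of the hyperquadric `⟨x, x⟩ = -1` has, at `a`, positive definite
induced metric, mean curvature zero (trace of the shape operator, the sum of the principal
curvatures) and Gauss-Kronecker curvature zero (determinant of the shape operator, the product
of the principal curvatures). -/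
def IsMinimalZeroGKAt (f : (Fin 3 → ℝ) → R51) (a : Fin 3 → ℝ) : Prop :=
  (∀ X, X ≠ 0 → 0 < firstForm f a X X) ∧
  (∃ ν, IsUnitNormal f a ν) ∧
  ∀ ν, IsUnitNormal f a ν →
    LinearMap.trace ℝ (Fin 3 → ℝ) (shapeOperator (Pi.basisFun ℝ (Fin 3)) f a ν) = 0 ∧
    LinearMap.det (shapeOperator (Pi.basisFun ℝ (Fin 3)) f a ν) = 0

end DeSitterPolar

end

noncomputable section

namespace DeSitterPolar

/-! Away from the branch point, stationarity together with conformality is the harmonic map equation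
`Δg = -2E g`, where `E` is the conformal factor; by continuity it also holds at `0`. For `f = g_x -
i g_y` it reads `2∂̄f = A f` with smooth coefficients `A`, because `2E` is a sum of terms `± conj
f_j * f_j`. A solution of such a system that vanishes at `0` is `z` times a smooth function
(`exists_eq_mul_of_dbar`), and the quotient solves the same system because `z` is holomorphic. The
branch form `ζ ^ (m + 1)` allows exactly `m` divisions, so `f = z ^ m ψ` with `ψ` smooth. If `Re
ψ(0)` were null, conformality would make `Re ψ(0)` and `Im ψ(0)` span a totally null space, hence be
proportional; but then the leading term of `g` would lie on a real line, against the branch form. So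
`Re ψ` and `Im ψ` are an orthogonal spacelike frame, with equal squared lengths `q > 0`, of the
tangent planes extended over the whole disc (`exists_isTangentFrame`).

The rest is algebra in this frame. The normal bundle is the zero set of the submersion `normalEq`.
Modulo multiples of `g`, `ψ` is holomorphic, so for a normal `w` the single complex number `H = ⟨w,
ψ_x⟩` (`frameCoeff`) carries the second fundamental form, which is `Re(z ^ m H X Y)`. Hence
`|z|^(2m) det A_w = -|H|² / q²`, an expression continuous across `z = 0`. The vectors tangent to the
bundle at `(z, w)` are the `(Z, W)` with `W ⊥ w, g` and `Z H + ⟨W, ψ⟩ = 0`, so the polar map `(Z, W)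
↦ W` is injective on them exactly when `H ≠ 0`. This gives part a).

At a regular point the image of the differential is the orthogonal complement of `w` and `g(z)`. It
is spacelike, and the unit normals of the polar hypersurface are multiples of `g(z)`.
Differentiating `⟨dΨ Y, g⟩ = 0` gives the second fundamental form `Re((z ^ m / H) ⟨W_X, ψ⟩ ⟨W_Y,
ψ⟩)`, where `W_X = dΨ X`. It only involves the two covectors dual to `Re ψ` and `Im ψ`, which are
orthogonal and of equal length, so it is traceless and, in dimension three, degenerate. This gives
part b). -/

lemma exists_bound_near {V : Type*} [NormedAddCommGroup V] {c : ℂ → V} {r : ℝ}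
    (hc : ContinuousOn c (Metric.ball 0 r)) {z : ℂ} (hz : z ∈ Metric.ball (0 : ℂ) r) :
    ∃ s, z ∈ Metric.ball (0 : ℂ) s ∧ s ≤ r ∧ ∃ M, ∀ y ∈ Metric.ball (0 : ℂ) s, ‖c y‖ ≤ M := by
  have hz' : ‖z‖ < r := by simpa using hz
  obtain ⟨s, h1, h2⟩ := exists_between hz'
  refine ⟨s, by simpa using h1, h2.le, ?_⟩
  obtain ⟨M, hM⟩ := (isCompact_closedBall (0 : ℂ) s).exists_bound_of_continuousOn
    (hc.mono (Metric.closedBall_subset_ball h2))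
  exact ⟨M, fun y hy => hM y (Metric.ball_subset_closedBall hy)⟩

/-! ### Radial averages and Hadamard's lemma -/

section RadialAverage

variable {V : Type*} [NormedAddCommGroup V] [NormedSpace ℝ V]

lemma smul_mem_ball_zero {r : ℝ} {z : ℂ} (hz : z ∈ Metric.ball (0 : ℂ) r) {t : ℝ}
    (ht : t ∈ Icc (0 : ℝ) 1) : t • z ∈ Metric.ball (0 : ℂ) r := by
  simp only [Metric.mem_ball, dist_zero_right, norm_smul, Real.norm_eq_abs] at *
  rw [abs_of_nonneg ht.1]
  nlinarith [norm_nonneg z, ht.1, ht.2]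

lemma continuousOn_comp_smul {c : ℂ → V} {r : ℝ} (hc : ContinuousOn c (Metric.ball 0 r)) (n : ℕ)
    {z : ℂ} (hz : z ∈ Metric.ball (0 : ℂ) r) :
    ContinuousOn (fun t : ℝ => t ^ n • c (t • z)) (Icc 0 1) := by
  refine ContinuousOn.smul (by fun_prop) (hc.comp (by fun_prop) ?_)
  intro t ht
  exact smul_mem_ball_zero hz ht

lemma continuousOn_radialAverage {c : ℂ → V} {r : ℝ}
    (hc : ContinuousOn c (Metric.ball 0 r)) (n : ℕ) :
    ContinuousOn (fun z : ℂ => ∫ t in (0 : ℝ)..1, t ^ n • c (t • z)) (Metric.ball 0 r) := by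
  intro z hz
  apply ContinuousAt.continuousWithinAt
  obtain ⟨s, hs, hsr, M, hM⟩ := exists_bound_near hc hz
  have hs' : Metric.ball (0 : ℂ) s ∈ 𝓝 z := Metric.isOpen_ball.mem_nhds hs
  apply intervalIntegral.continuousAt_of_dominated_interval (bound := fun _ => M)
  · filter_upwards [hs'] with y hy
    have := continuousOn_comp_smul hc n (Metric.ball_subset_ball hsr hy)
    rw [uIoc_of_le zero_le_one]
    exact (this.mono Ioc_subset_Icc_self).aestronglyMeasurable measurableSet_Ioc
  · filter_upwards [hs'] with y hy
    refine Eventually.of_forall fun t ht => ?_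
    rw [uIoc_of_le zero_le_one] at ht
    have ht' := Ioc_subset_Icc_self ht
    rw [norm_smul, Real.norm_eq_abs, abs_of_nonneg (pow_nonneg ht'.1 n)]
    have h1 := hM _ (smul_mem_ball_zero hy ht')
    have h2 : t ^ n ≤ 1 := pow_le_one₀ ht'.1 ht'.2
    nlinarith [norm_nonneg (c (t • y)), pow_nonneg ht'.1 n]
  · exact intervalIntegrable_const
  · refine Eventually.of_forall fun t ht => ?_
    rw [uIoc_of_le zero_le_one] at ht
    have ht' := Ioc_subset_Icc_self ht
    have h1 : ContinuousAt c (t • z) :=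
      hc.continuousAt (Metric.isOpen_ball.mem_nhds (smul_mem_ball_zero hz ht'))
    have h2 : ContinuousAt (fun y : ℂ => c (t • y)) z :=
      ContinuousAt.comp (f := fun y : ℂ => t • y) h1 (by fun_prop)
    exact continuousAt_const.smul h2

lemma hasFDerivAt_radialAverage {c : ℂ → V} {r : ℝ}
    (hc : ContDiffOn ℝ 1 c (Metric.ball 0 r)) (n : ℕ) {z : ℂ} (hz : z ∈ Metric.ball (0 : ℂ) r) :
    HasFDerivAt (fun z : ℂ => ∫ t in (0 : ℝ)..1, t ^ n • c (t • z))
      (∫ t in (0 : ℝ)..1, t ^ (n + 1) • fderiv ℝ c (t • z)) z := by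
  have hdc : ContinuousOn (fderiv ℝ c) (Metric.ball 0 r) :=
    hc.continuousOn_fderiv_of_isOpen Metric.isOpen_ball le_rfl
  obtain ⟨s, hs, hsr, M, hM⟩ := exists_bound_near hdc hz
  have hs' : Metric.ball (0 : ℂ) s ∈ 𝓝 z := Metric.isOpen_ball.mem_nhds hs
  refine (intervalIntegral.hasFDerivAt_integral_of_dominated_of_fderiv_le
    (bound := fun _ => M) (F' := fun z t => t ^ (n + 1) • fderiv ℝ c (t • z)) hs'
    ?_ ?_ ?_ ?_ ?_ ?_)
  · filter_upwards [hs'] with y hy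
    have := continuousOn_comp_smul hc.continuousOn n (Metric.ball_subset_ball hsr hy)
    rw [uIoc_of_le zero_le_one]
    exact (this.mono Ioc_subset_Icc_self).aestronglyMeasurable measurableSet_Ioc
  · apply ContinuousOn.intervalIntegrable
    rw [uIcc_of_le zero_le_one]
    exact continuousOn_comp_smul hc.continuousOn n hz
  · have := continuousOn_comp_smul hdc (n + 1) hz
    rw [uIoc_of_le zero_le_one]
    exact (this.mono Ioc_subset_Icc_self).aestronglyMeasurable measurableSet_Ioc
  · refine Eventually.of_forall fun t ht y hy => ?_
    rw [uIoc_of_le zero_le_one] at ht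
    have ht' := Ioc_subset_Icc_self ht
    rw [norm_smul, Real.norm_eq_abs, abs_of_nonneg (pow_nonneg ht'.1 _)]
    have h1 := hM _ (smul_mem_ball_zero hy ht')
    have h2 : t ^ (n + 1) ≤ 1 := pow_le_one₀ ht'.1 ht'.2
    nlinarith [norm_nonneg (fderiv ℝ c (t • y)), pow_nonneg ht'.1 (n + 1)]
  · exact intervalIntegrable_const
  · refine Eventually.of_forall fun t ht y hy => ?_
    rw [uIoc_of_le zero_le_one] at ht
    have ht' := Ioc_subset_Icc_self ht
    have hmem := smul_mem_ball_zero (Metric.ball_subset_ball hsr hy) ht'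
    have h1 : HasFDerivAt c (fderiv ℝ c (t • y)) (t • y) :=
      ((hc.contDiffAt (Metric.isOpen_ball.mem_nhds hmem)).differentiableAt one_ne_zero).hasFDerivAt
    have h2 : HasFDerivAt (fun y : ℂ => t • y) (t • ContinuousLinearMap.id ℝ ℂ) y :=
      (hasFDerivAt_id y).const_smul t
    have h3 := (h1.comp y h2).const_smul (t ^ n)
    refine h3.congr_fderiv ?_
    ext X
    simp [pow_succ, mul_smul]

end RadialAverage

universe u

/-- Differentiation raises the weight from `n` to `n + 1` and replaces `V` by `ℂ →L[ℝ] V`, so the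
induction generalises over both. -/
lemma contDiffOn_radialAverage_nat (k : ℕ) : ∀ {V : Type u} [NormedAddCommGroup V]
    [NormedSpace ℝ V] {c : ℂ → V} {r : ℝ} (_ : ContDiffOn ℝ k c (Metric.ball 0 r)) (n : ℕ),
    ContDiffOn ℝ k (fun z : ℂ => ∫ t in (0 : ℝ)..1, t ^ n • c (t • z)) (Metric.ball 0 r) := by
  induction k with
  | zero =>
    intro V _ _ c r hc n
    exact contDiffOn_zero.2 (continuousOn_radialAverage hc.continuousOn n)
  | succ k ih =>
    intro V _ _ c r hc n
    have hc1 : ContDiffOn ℝ 1 c (Metric.ball 0 r) := hc.of_le (by norm_cast; omega)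
    push_cast at hc ⊢
    rw [contDiffOn_succ_iff_fderiv_of_isOpen Metric.isOpen_ball] at hc ⊢
    refine ⟨fun z hz => (hasFDerivAt_radialAverage hc1 n hz).differentiableAt.differentiableWithinAt,
      by simp, ?_⟩
    refine (ih hc.2.2 (n + 1)).congr fun z hz => ?_
    exact (hasFDerivAt_radialAverage hc1 n hz).fderiv

lemma contDiffOn_radialAverage {V : Type u} [NormedAddCommGroup V]
    [NormedSpace ℝ V] {c : ℂ → V} {r : ℝ} (hc : ContDiffOn ℝ ∞ c (Metric.ball 0 r)) (n : ℕ) :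
    ContDiffOn ℝ ∞ (fun z : ℂ => ∫ t in (0 : ℝ)..1, t ^ n • c (t • z)) (Metric.ball 0 r) := by
  rw [contDiffOn_infty] at *
  exact fun k => contDiffOn_radialAverage_nat k (hc k) n

/-- Hadamard's lemma in complex coordinates. -/
lemma eq_mul_add_conj_mul_radialAverage {f : ℂ → ℂ} {r : ℝ}
    (hf : ContDiffOn ℝ 1 f (Metric.ball 0 r)) (h0 : f 0 = 0) {z : ℂ}
    (hz : z ∈ Metric.ball (0 : ℂ) r) :
    f z = z * (∫ t in (0 : ℝ)..1, t ^ 0 • ((fderiv ℝ f (t • z) 1 -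
        Complex.I * fderiv ℝ f (t • z) Complex.I) / 2)) +
      (starRingEnd ℂ) z * ∫ t in (0 : ℝ)..1, ((fderiv ℝ f (t • z) 1 +
        Complex.I * fderiv ℝ f (t • z) Complex.I) / 2) := by
  have hdf : ContinuousOn (fderiv ℝ f) (Metric.ball 0 r) :=
    hf.continuousOn_fderiv_of_isOpen Metric.isOpen_ball le_rfl
  have hd : ∀ t ∈ Icc (0 : ℝ) 1,
      HasDerivAt (fun t : ℝ => f (t • z)) (fderiv ℝ f (t • z) z) t := by
    intro t ht
    have hmem := smul_mem_ball_zero hz ht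
    have h1 : HasFDerivAt f (fderiv ℝ f (t • z)) (t • z) :=
      ((hf.contDiffAt (Metric.isOpen_ball.mem_nhds hmem)).differentiableAt one_ne_zero).hasFDerivAt
    have h2 : HasDerivAt (fun t : ℝ => t • z) ((1 : ℝ) • z) t := (hasDerivAt_id t).smul_const z
    have h3 := h1.comp_hasDerivAt t h2
    rw [one_smul] at h3
    exact h3
  have hcont : ∀ X : ℂ, ContinuousOn (fun t : ℝ => fderiv ℝ f (t • z) X) (Icc 0 1) := by
    intro X
    have := continuousOn_comp_smul hdf 0 hz
    simp only [pow_zero, one_smul] at this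
    exact this.clm_apply continuousOn_const
  have hint := intervalIntegral.integral_eq_sub_of_hasDerivAt (a := 0) (b := 1)
    (f := fun t : ℝ => f (t • z)) (f' := fun t => fderiv ℝ f (t • z) z)
    (by rw [uIcc_of_le zero_le_one]; exact hd)
    (by apply ContinuousOn.intervalIntegrable; rw [uIcc_of_le zero_le_one]; exact hcont z)
  simp only [one_smul, zero_smul, h0, sub_zero] at hint
  rw [← hint, ← intervalIntegral.integral_const_mul, ← intervalIntegral.integral_const_mul,
    ← intervalIntegral.integral_add]
  · congr 1
    ext t
    have h1 : fderiv ℝ f (t • z) z = z.re * fderiv ℝ f (t • z) 1 +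
        z.im * fderiv ℝ f (t • z) Complex.I := by
      conv_lhs => rw [show z = z.re • (1 : ℂ) + z.im • Complex.I by simp]
      rw [map_add, map_smul, map_smul]
      simp
    rw [h1]
    generalize fderiv ℝ f (t • z) = T
    conv_rhs => rw [← Complex.re_add_im z]
    simp only [map_add, map_mul, Complex.conj_ofReal, Complex.conj_I, pow_zero, one_smul]
    linear_combination ((z.im : ℂ) * T Complex.I) * Complex.I_sq
  all_goals
    apply ContinuousOn.intervalIntegrable
    rw [uIcc_of_le zero_le_one]
    have h1 := hcont 1
    have h2 := hcont Complex.I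
    fun_prop

/-! ### Finite differentiability of `conj z ^ n / z ^ j` -/

lemma norm_conj_pow_div_pow_le {n j : ℕ} (h : j ≤ n) (z : ℂ) :
    ‖(starRingEnd ℂ) z ^ n / z ^ j‖ ≤ ‖z‖ ^ (n - j) := by
  rw [norm_div, norm_pow, norm_pow, RCLike.norm_conj]
  rcases eq_or_ne z 0 with rfl | hz
  · rcases Nat.eq_zero_or_pos j with rfl | hj
    · simp
    · simp [hj.ne']
  · rw [pow_sub₀ _ (norm_ne_zero_iff.2 hz) h, div_eq_mul_inv]

lemma hasFDerivAt_conj_pow_div_pow {n j : ℕ} (h : j + 2 ≤ n) (z : ℂ) :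
    HasFDerivAt (fun z : ℂ => (starRingEnd ℂ) z ^ n / z ^ j)
      ((n * ((starRingEnd ℂ) z ^ (n - 1) / z ^ j)) • (Complex.conjCLE : ℂ →L[ℝ] ℂ) -
        (j * ((starRingEnd ℂ) z ^ n / z ^ (j + 1))) • ContinuousLinearMap.id ℝ ℂ) z := by
  rcases eq_or_ne z 0 with rfl | hz
  -- At the origin the quotient is `O(|z|²)`, so its derivative is zero; both terms of the formula
  -- vanish there too, with `0 / 0 = 0`.
  · have h1 : (n - 1) ≠ 0 := by omega
    have h2 : n ≠ 0 := by omega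
    have h3 : (fun z : ℂ => (starRingEnd ℂ) z ^ n / z ^ j) =O[𝓝 0]
        fun x => ‖x - 0‖ ^ (n - j) := by
      refine IsBigO.of_bound 1 (Eventually.of_forall fun z => ?_)
      simpa using norm_conj_pow_div_pow_le (by omega) z
    have h4 := h3.hasFDerivAt (𝕜 := ℝ) (by omega)
    refine h4.congr_fderiv ?_
    ext X
    simp [h1, h2]
  · have h1 : HasFDerivAt (fun z : ℂ => (starRingEnd ℂ) z) (Complex.conjCLE : ℂ →L[ℝ] ℂ) z :=
      Complex.conjCLE.hasFDerivAt
    have h2 : HasFDerivAt (fun z : ℂ => (starRingEnd ℂ) z ^ n) _ z := h1.pow n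
    have h3 : HasFDerivAt (fun z : ℂ => (z ^ j)⁻¹) _ z :=
      (((hasDerivAt_pow j z).fun_inv (pow_ne_zero j hz)).hasFDerivAt).restrictScalars ℝ
    have h4 : HasFDerivAt (fun z : ℂ => (starRingEnd ℂ) z ^ n * (z ^ j)⁻¹) _ z := h2.mul h3
    simp only [← div_eq_mul_inv] at h4
    refine h4.congr_fderiv ?_
    ext X
    simp
    rcases Nat.eq_zero_or_pos j with rfl | hj
    · simp
    · obtain ⟨i, rfl⟩ : ∃ i, j = i + 1 := ⟨j - 1, by omega⟩
      simp
      field_simp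
      ring

/-- Each differentiation lowers the excess `n - j` by one, and an excess of one suffices for
continuity. -/
lemma contDiff_conj_pow_div_pow (k : ℕ) : ∀ {n j : ℕ}, j + k + 1 ≤ n →
    ContDiff ℝ k (fun z : ℂ => (starRingEnd ℂ) z ^ n / z ^ j) := by
  induction k with
  | zero =>
    intro n j h
    refine contDiff_zero.2 (continuous_iff_continuousAt.2 fun z => ?_)
    rcases eq_or_ne z 0 with rfl | hz
    · have h1 : n ≠ 0 := by omega
      have h2 : n - j ≠ 0 := by omega
      rw [ContinuousAt]
      simp only [map_zero, zero_pow h1, zero_div]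
      refine squeeze_zero_norm (norm_conj_pow_div_pow_le (by omega)) ?_
      have : Continuous fun z : ℂ => ‖z‖ ^ (n - j) := by fun_prop
      simpa [h2] using this.tendsto 0
    · exact ContinuousAt.div (by fun_prop) (by fun_prop) (pow_ne_zero j hz)
  | succ k ih =>
    intro n j h
    push_cast
    rw [contDiff_succ_iff_fderiv]
    refine ⟨fun z => (hasFDerivAt_conj_pow_div_pow (by omega) z).differentiableAt, by simp, ?_⟩
    have : fderiv ℝ (fun z : ℂ => (starRingEnd ℂ) z ^ n / z ^ j) = fun z =>
      ((n * ((starRingEnd ℂ) z ^ (n - 1) / z ^ j)) • (Complex.conjCLE : ℂ →L[ℝ] ℂ) -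
        (j * ((starRingEnd ℂ) z ^ n / z ^ (j + 1))) • ContinuousLinearMap.id ℝ ℂ) := by
      ext1 z
      exact (hasFDerivAt_conj_pow_div_pow (by omega) z).fderiv
    rw [this]
    have h1 := ih (n := n - 1) (j := j) (by omega)
    have h2 := ih (n := n) (j := j + 1) (by omega)
    exact ((contDiff_const.mul h1).smul contDiff_const).sub
      ((contDiff_const.mul h2).smul contDiff_const)

/-! ### Division by `z` for linear `∂̄`-systems -/

section Division

variable {ι : Type*} [Fintype ι] {r : ℝ}

/-- A solution of a linear `∂̄`-system which vanishes at the origin is, up to terms of arbitrarily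
high order in `conj z`, divisible by `z`. -/
lemma exists_eq_mul_add_conj_pow_mul {A : ι → ι → ℂ → ℂ} {f : ι → ℂ → ℂ}
    (hA : ∀ i j, ContDiffOn ℝ ∞ (A i j) (Metric.ball 0 r))
    (hf : ∀ i, ContDiffOn ℝ ∞ (f i) (Metric.ball 0 r))
    (heq : ∀ i, ∀ z ∈ Metric.ball (0 : ℂ) r, fderiv ℝ (f i) z 1 +
      Complex.I * fderiv ℝ (f i) z Complex.I = ∑ j, A i j z * f j z)
    (h0 : ∀ i, f i 0 = 0) (n : ℕ) :
    ∃ a b : ι → ℂ → ℂ, (∀ i, ContDiffOn ℝ ∞ (a i) (Metric.ball 0 r)) ∧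
      (∀ i, ContDiffOn ℝ ∞ (b i) (Metric.ball 0 r)) ∧
      ∀ i, ∀ z ∈ Metric.ball (0 : ℂ) r, f i z = z * a i z + (starRingEnd ℂ) z ^ n * b i z := by
  induction n with
  | zero => exact ⟨fun _ _ => 0, f, fun _ => contDiffOn_const, hf, fun i z _ => by simp⟩
  | succ n ih =>
    obtain ⟨a, b, ha, hb, hab⟩ := ih
    have hdf : ∀ i X, ContDiffOn ℝ ∞ (fun z => fderiv ℝ (f i) z X) (Metric.ball 0 r) := fun i X =>
      ((contDiffOn_infty_iff_fderiv_of_isOpen Metric.isOpen_ball).1 (hf i)).2.clm_apply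
        contDiffOn_const
    have hSa : ∀ i, ContDiffOn ℝ ∞ (fun z => (∑ j, A i j z * a j z) / 2) (Metric.ball 0 r) :=
      fun i => (ContDiffOn.sum fun j _ => (hA i j).mul (ha j)).div_const 2
    have hSb : ∀ i, ContDiffOn ℝ ∞ (fun z => (∑ j, A i j z * b j z) / 2) (Metric.ball 0 r) :=
      fun i => (ContDiffOn.sum fun j _ => (hA i j).mul (hb j)).div_const 2
    have hconj : ContDiffOn ℝ ∞ (fun z : ℂ => (starRingEnd ℂ) z) (Metric.ball 0 r) :=
      Complex.conjCLE.contDiff.contDiffOn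
    refine ⟨fun i z => (∫ t in (0 : ℝ)..1, t ^ 0 • ((fderiv ℝ (f i) (t • z) 1 -
        Complex.I * fderiv ℝ (f i) (t • z) Complex.I) / 2)) +
        (starRingEnd ℂ) z * ∫ t in (0 : ℝ)..1, t ^ 1 • ((∑ j, A i j (t • z) * a j (t • z)) / 2),
      fun i z => ∫ t in (0 : ℝ)..1, t ^ n • ((∑ j, A i j (t • z) * b j (t • z)) / 2),
      fun i => ?_, fun i => contDiffOn_radialAverage (hSb i) n, fun i z hz => ?_⟩
    · refine (contDiffOn_radialAverage (c := fun z => (fderiv ℝ (f i) z 1 -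
        Complex.I * fderiv ℝ (f i) z Complex.I) / 2) ?_ 0).add
        (hconj.mul (contDiffOn_radialAverage (hSa i) 1))
      exact ((hdf i 1).sub (contDiffOn_const.mul (hdf i Complex.I))).div_const 2
    · rw [eq_mul_add_conj_mul_radialAverage ((hf i).of_le (by simp)) (h0 i) hz, mul_add, add_assoc]
      congr 1
      -- In Hadamard's formula the factor of `conj z` is an average of `∂̄f = A f / 2`. Inserting
      -- the expansion of `f` known for `n` gives one term divisible by `z` and one carrying `conj z
      -- ^ n`; the prefactor `conj z` raises the exponent to `n + 1`.
      have key : ∫ t in (0 : ℝ)..1, ((fderiv ℝ (f i) (t • z) 1 +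
          Complex.I * fderiv ℝ (f i) (t • z) Complex.I) / 2) =
          z * (∫ t in (0 : ℝ)..1, t ^ 1 • ((∑ j, A i j (t • z) * a j (t • z)) / 2)) +
          (starRingEnd ℂ) z ^ n *
            ∫ t in (0 : ℝ)..1, t ^ n • ((∑ j, A i j (t • z) * b j (t • z)) / 2) := by
        rw [← intervalIntegral.integral_const_mul, ← intervalIntegral.integral_const_mul,
          ← intervalIntegral.integral_add]
        · refine intervalIntegral.integral_congr fun t ht => ?_
          rw [uIcc_of_le zero_le_one] at ht
          have hmem := smul_mem_ball_zero hz ht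
          rw [heq i _ hmem]
          have : ∀ j, A i j (t • z) * f j (t • z) = (t * z) * (A i j (t • z) * a j (t • z)) +
              (t * (starRingEnd ℂ) z) ^ n * (A i j (t • z) * b j (t • z)) := by
            intro j
            rw [hab j _ hmem]
            simp only [Complex.real_smul, map_mul, Complex.conj_ofReal]
            ring
          simp only [this, Finset.sum_add_distrib, ← Finset.mul_sum]
          simp only [Complex.real_smul, Complex.ofReal_pow]
          ring
        · apply ContinuousOn.intervalIntegrable
          rw [uIcc_of_le zero_le_one]
          exact continuousOn_const.mul (continuousOn_comp_smul (hSa i).continuousOn 1 hz)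
        · apply ContinuousOn.intervalIntegrable
          rw [uIcc_of_le zero_le_one]
          exact continuousOn_const.mul (continuousOn_comp_smul (hSb i).continuousOn n hz)
      rw [key]
      ring

/-- A solution of a linear `∂̄`-system which vanishes at the origin is divisible by `z`. -/
lemma exists_eq_mul_of_dbar {A : ι → ι → ℂ → ℂ} {f : ι → ℂ → ℂ} (hr : 0 < r)
    (hA : ∀ i j, ContDiffOn ℝ ∞ (A i j) (Metric.ball 0 r))
    (hf : ∀ i, ContDiffOn ℝ ∞ (f i) (Metric.ball 0 r))
    (heq : ∀ i, ∀ z ∈ Metric.ball (0 : ℂ) r, fderiv ℝ (f i) z 1 +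
      Complex.I * fderiv ℝ (f i) z Complex.I = ∑ j, A i j z * f j z)
    (h0 : ∀ i, f i 0 = 0) :
    ∃ q : ι → ℂ → ℂ, (∀ i, ContDiffOn ℝ ∞ (q i) (Metric.ball 0 r)) ∧
      ∀ i, ∀ z ∈ Metric.ball (0 : ℂ) r, f i z = z * q i z := by
  choose a b ha hb hab using exists_eq_mul_add_conj_pow_mul hA hf heq h0
  have hmem0 : (0 : ℂ) ∈ Metric.ball (0 : ℂ) r := by simpa using hr
  have hform : ∀ n i, ∀ z ∈ Metric.ball (0 : ℂ) r, z ≠ 0 →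
      f i z / z = a n i z + (starRingEnd ℂ) z ^ n / z ^ 1 * b n i z := by
    intro n i z hz hz0
    rw [hab n i z hz]
    field_simp
  have hlim : ∀ n, 2 ≤ n → ∀ i, Tendsto (fun z => f i z / z) (𝓝[≠] 0) (𝓝 (a n i 0)) := by
    intro n hn i
    have h1 : ContinuousAt (fun z => a n i z + (starRingEnd ℂ) z ^ n / z ^ 1 * b n i z) 0 := by
      have hA1 := (ha n i).continuousOn.continuousAt (Metric.isOpen_ball.mem_nhds hmem0)
      have hB1 := (hb n i).continuousOn.continuousAt (Metric.isOpen_ball.mem_nhds hmem0)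
      exact hA1.add ((contDiff_conj_pow_div_pow 0 (by omega)).continuous.continuousAt.mul hB1)
    have h2 : Tendsto (fun z => a n i z + (starRingEnd ℂ) z ^ n / z ^ 1 * b n i z) (𝓝[≠] 0)
        (𝓝 (a n i 0)) := by
      have := h1.tendsto.mono_left (nhdsWithin_le_nhds (s := {0}ᶜ))
      simpa using this
    refine h2.congr' ?_
    filter_upwards [self_mem_nhdsWithin,
      nhdsWithin_le_nhds (Metric.isOpen_ball.mem_nhds hmem0)] with z hz hz'
    exact (hform n i z hz' hz).symm
  -- The coefficients `a n` depend on `n`, but for `n ≥ 2` they share the value at `0`, namely the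
  -- limit of `f / z`; this is the value given to the quotient there.
  have hval : ∀ n, 2 ≤ n → ∀ i, a n i 0 = a 2 i 0 := fun n hn i =>
    tendsto_nhds_unique (hlim n hn i) (hlim 2 le_rfl i)
  refine ⟨fun i z => if z = 0 then a 2 i 0 else f i z / z, fun i => ?_, fun i z hz => ?_⟩
  · rw [contDiffOn_infty]
    intro k
    -- Taking `n = k + 2` makes `conj z ^ n / z` of class `C^k`. The quotient does not depend on
    -- `n`, so it is smooth.
    have h1 : ContDiffOn ℝ k
        (fun z => a (k + 2) i z + (starRingEnd ℂ) z ^ (k + 2) / z ^ 1 * b (k + 2) i z)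
        (Metric.ball 0 r) :=
      ((contDiffOn_infty.1 (ha _ i)) k).add
        ((contDiff_conj_pow_div_pow k (by omega)).contDiffOn.mul ((contDiffOn_infty.1 (hb _ i)) k))
    refine h1.congr fun z hz => ?_
    beta_reduce
    split_ifs with h
    · subst h
      simp [hval (k + 2) (by omega) i]
    · exact hform _ i z hz h
  · rcases eq_or_ne z 0 with rfl | hz0
    · simp [h0]
    · simp only [if_neg hz0]
      field_simp

end Division

/-! ### Slice charts and tangent spaces of zero sets -/

section SliceCharts

variable {E F G : Type*} [NormedAddCommGroup E] [NormedSpace ℝ E] [FiniteDimensional ℝ E]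
  [NormedAddCommGroup F] [NormedSpace ℝ F] [FiniteDimensional ℝ F]
  [NormedAddCommGroup G] [NormedSpace ℝ G] [FiniteDimensional ℝ G]

/-- The zero set of a submersion has slice charts. -/
lemma exists_isSliceChart_of_surjective {S U : Set E} {Φ : E → G} (hU : IsOpen U)
    (hΦ : ContDiffOn ℝ ∞ Φ U) (hS : ∀ x ∈ U, x ∈ S ↔ Φ x = 0) {p : E} (hp : p ∈ U)
    (hsurj : Function.Surjective (fderiv ℝ Φ p))
    (hdim : Module.finrank ℝ F + Module.finrank ℝ G = Module.finrank ℝ E) :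
    ∃ e : OpenPartialHomeomorph E (F × G), IsSliceChart S e ∧ p ∈ e.source := by
  set L := fderiv ℝ Φ p with hL
  -- A projection onto the kernel of the differential completes `Φ` to a map `Θ` with invertible
  -- differential at `p`; the inverse function theorem then gives the chart.
  obtain ⟨π, hπ⟩ := L.ker_closedComplemented_of_finiteDimensional_range
  have hker : Module.finrank ℝ (LinearMap.ker (L : E →ₗ[ℝ] G)) = Module.finrank ℝ F := by
    have h1 := (L : E →ₗ[ℝ] G).finrank_range_add_finrank_ker
    have h2 : LinearMap.range (L : E →ₗ[ℝ] G) = ⊤ := LinearMap.range_eq_top.2 hsurj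
    rw [h2, finrank_top] at h1
    omega
  let κ := ContinuousLinearEquiv.ofFinrankEq hker
  let T : E →L[ℝ] F := (κ : _ →L[ℝ] F).comp π
  let Θ : E → F × G := fun x => (T x, Φ x)
  have hΘ : ContDiffOn ℝ ∞ Θ U := T.contDiff.contDiffOn.prodMk hΦ
  have hdΘ : fderiv ℝ Θ p = T.prod L :=
    (T.hasFDerivAt.prodMk (((hΦ.contDiffAt (hU.mem_nhds hp)).differentiableAt
      (by simp)).hasFDerivAt)).fderiv
  have hfin : Module.finrank ℝ E = Module.finrank ℝ (F × G) := by
    rw [Module.finrank_prod, hdim]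
  have hinj : Function.Injective (T.prod L) := by
    rw [injective_iff_map_eq_zero]
    intro x hx
    have h1 : T x = 0 := congrArg Prod.fst hx
    have h2 : L x = 0 := congrArg Prod.snd hx
    have h3 : π x = 0 := κ.injective (by simpa [T] using h1)
    have h4 := hπ ⟨x, h2⟩
    rw [h3] at h4
    exact (congrArg Subtype.val h4).symm
  have hunit : fderiv ℝ Θ p ∈ range ((↑) : (E ≃L[ℝ] F × G) → E →L[ℝ] F × G) := by
    rw [hdΘ]
    refine ⟨(LinearEquiv.ofInjectiveOfFinrankEq (T.prod L : E →ₗ[ℝ] F × G) hinj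
      hfin).toContinuousLinearEquiv, ?_⟩
    ext x <;> rfl
  -- Restricting to the open set where the differential stays invertible makes the inverse smooth on
  -- the whole target, not only near the image of `p`.
  let W := U ∩ fderiv ℝ Θ ⁻¹' range ((↑) : (E ≃L[ℝ] F × G) → E →L[ℝ] F × G)
  have hW : IsOpen W :=
    (hΘ.continuousOn_fderiv_of_isOpen hU (by simp)).isOpen_inter_preimage hU
      ContinuousLinearEquiv.isOpen
  have hcd : ∀ x ∈ U, ContDiffAt ℝ ∞ Θ x := fun x hx => hΘ.contDiffAt (hU.mem_nhds hx)
  obtain ⟨A, hA⟩ := hunit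
  have hAd : HasFDerivAt Θ (A : E →L[ℝ] F × G) p := by
    rw [hA]
    exact ((hcd p hp).differentiableAt (by simp)).hasFDerivAt
  let e := ((hcd p hp).toOpenPartialHomeomorph Θ hAd (by simp)).restrOpen W hW
  have he : ∀ x, e x = Θ x := fun x => rfl
  refine ⟨e, ⟨⟨?_, ?_⟩, ?_⟩, ?_⟩
  · intro x hx
    exact (hcd x hx.2.1).contDiffWithinAt
  · intro y hy
    have hx := e.map_target hy
    obtain ⟨B, hB⟩ := hx.2.2
    refine (e.contDiffAt_symm (f₀' := B) hy ?_ (hcd _ hx.2.1)).contDiffWithinAt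
    rw [hB]
    exact ((hcd _ hx.2.1).differentiableAt (by simp)).hasFDerivAt
  · intro x hx
    exact hS x hx.2.1
  · exact ⟨(hcd p hp).mem_toOpenPartialHomeomorph_source hAd (by simp), hp, A, hA⟩

variable {S U : Set E} {e : OpenPartialHomeomorph E (F × G)} {p : E}

omit [FiniteDimensional ℝ E] [FiniteDimensional ℝ F] [FiniteDimensional ℝ G]

lemma sliceParam_apply_fst (he : IsSliceChart S e) (hp : p ∈ S) (hpe : p ∈ e.source) :
    sliceParam e (e p).1 = p := by
  have h : ((e p).1, (0 : G)) = e p := Prod.ext rfl ((he.2 p hpe).1 hp).symm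
  rw [sliceParam, h, e.left_inv hpe]

lemma eventually_mem_target (he : IsSliceChart S e) (hp : p ∈ S) (hpe : p ∈ e.source) :
    ∀ᶠ a in 𝓝 (e p).1, (a, (0 : G)) ∈ e.target := by
  have h : ((e p).1, (0 : G)) = e p := Prod.ext rfl ((he.2 p hpe).1 hp).symm
  have h1 : e.target ∈ 𝓝 ((e p).1, (0 : G)) :=
    e.open_target.mem_nhds (h ▸ e.map_source hpe)
  have h2 : ContinuousAt (fun a : F => (a, (0 : G))) (e p).1 := by fun_prop
  exact h2 h1

lemma contDiffAt_sliceParam (he : IsSliceChart S e) (hp : p ∈ S) (hpe : p ∈ e.source) :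
    ContDiffAt ℝ ∞ (sliceParam e) (e p).1 := by
  have h := (eventually_mem_target he hp hpe).self_of_nhds
  have h1 : ContDiffAt ℝ ∞ e.symm ((e p).1, (0 : G)) :=
    he.1.2.contDiffAt (e.open_target.mem_nhds h)
  have h2 : ContDiffAt ℝ ∞ (fun a : F => (a, (0 : G))) (e p).1 := by fun_prop
  exact h1.comp (e p).1 h2

lemma eventually_sliceParam_mem (he : IsSliceChart S e) (hp : p ∈ S) (hpe : p ∈ e.source) :
    ∀ᶠ a in 𝓝 (e p).1, sliceParam e a ∈ S := by
  filter_upwards [eventually_mem_target he hp hpe] with a ha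
  rw [sliceParam, he.2 _ (e.map_target ha), e.right_inv ha]

/-- The first component of the chart is a left inverse of the parametrization. -/
lemma fderiv_sliceParam_injective (he : IsSliceChart S e) (hp : p ∈ S) (hpe : p ∈ e.source) :
    Function.Injective (fderiv ℝ (sliceParam e) (e p).1) := by
  have h1 := ((contDiffAt_sliceParam he hp hpe).differentiableAt (by simp)).hasFDerivAt
  have h2 : HasFDerivAt e (fderiv ℝ e p) (sliceParam e (e p).1) := by
    rw [sliceParam_apply_fst he hp hpe]
    exact ((he.1.1.contDiffAt (e.open_source.mem_nhds hpe)).differentiableAt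
      (by simp)).hasFDerivAt
  have h3 := (h2.comp (e p).1 h1).fst
  have h4 : HasFDerivAt (fun a => (e (sliceParam e a)).1) (ContinuousLinearMap.id ℝ F) (e p).1 := by
    refine (hasFDerivAt_id _).congr_of_eventuallyEq ?_
    filter_upwards [eventually_mem_target he hp hpe] with a ha
    simp [sliceParam, e.right_inv ha]
  have h5 := h3.unique h4
  intro X Y hXY
  have h6 := congrArg (fun T : F →L[ℝ] F => T X) h5
  have h7 := congrArg (fun T : F →L[ℝ] F => T Y) h5
  simp only [ContinuousLinearMap.comp_apply, ContinuousLinearMap.id_apply] at h6 h7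
  rw [← h6, hXY, h7]

/-- The tangent space of the zero set of `Φ` lies in the kernel of the differential of `Φ`. -/
lemma fderiv_sliceParam_mem_ker {Φ : E → G} (hU : IsOpen U)
    (hΦ : ContDiffOn ℝ ∞ Φ U) (hS : ∀ x ∈ U, x ∈ S ↔ Φ x = 0)
    (he : IsSliceChart S e) (hp : p ∈ S) (hpe : p ∈ e.source) (hpU : p ∈ U) (X : F) :
    fderiv ℝ Φ p (fderiv ℝ (sliceParam e) (e p).1 X) = 0 := by
  have hsp := sliceParam_apply_fst he hp hpe
  have hc := contDiffAt_sliceParam he hp hpe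
  have h1 := (hc.differentiableAt (by simp)).hasFDerivAt
  have h2 : HasFDerivAt Φ (fderiv ℝ Φ p) (sliceParam e (e p).1) := by
    rw [hsp]
    exact ((hΦ.contDiffAt (hU.mem_nhds hpU)).differentiableAt (by simp)).hasFDerivAt
  have h3 : HasFDerivAt (fun a => Φ (sliceParam e a)) (0 : F →L[ℝ] G) (e p).1 := by
    refine (hasFDerivAt_const (0 : G) _).congr_of_eventuallyEq ?_
    have hev : ∀ᶠ a in 𝓝 (e p).1, sliceParam e a ∈ U :=
      hc.continuousAt (hU.mem_nhds (by rw [hsp]; exact hpU))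
    filter_upwards [eventually_sliceParam_mem he hp hpe, hev] with a ha hb
    exact (hS _ hb).1 ha
  have h4 := (h2.comp (e p).1 h1).unique h3
  exact congrArg (fun T : F →L[ℝ] G => T X) h4

variable [FiniteDimensional ℝ E]

/-- The tangent space of the zero set of a submersion `Φ` is the kernel of its differential. -/
lemma exists_fderiv_sliceParam_eq {Φ : E → G} (hU : IsOpen U)
    (hΦ : ContDiffOn ℝ ∞ Φ U) (hS : ∀ x ∈ U, x ∈ S ↔ Φ x = 0)
    (he : IsSliceChart S e) (hp : p ∈ S) (hpe : p ∈ e.source) (hpU : p ∈ U)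
    (hsurj : Function.Surjective (fderiv ℝ Φ p))
    (hdim : Module.finrank ℝ F + Module.finrank ℝ G = Module.finrank ℝ E) {v : E}
    (hv : fderiv ℝ Φ p v = 0) :
    ∃ X, fderiv ℝ (sliceParam e) (e p).1 X = v := by
  set L := fderiv ℝ Φ p
  set D := fderiv ℝ (sliceParam e) (e p).1
  have hle : LinearMap.range (D : F →ₗ[ℝ] E) ≤ LinearMap.ker (L : E →ₗ[ℝ] G) := by
    rintro _ ⟨X, rfl⟩
    exact fderiv_sliceParam_mem_ker hU hΦ hS he hp hpe hpU X
  have h1 : Module.finrank ℝ (LinearMap.range (D : F →ₗ[ℝ] E)) = Module.finrank ℝ F :=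
    LinearMap.finrank_range_of_inj (fderiv_sliceParam_injective he hp hpe)
  have h2 := (L : E →ₗ[ℝ] G).finrank_range_add_finrank_ker
  -- The tangent space is contained in the kernel, and both have the dimension of `F`.
  have h3 : LinearMap.range (L : E →ₗ[ℝ] G) = ⊤ := LinearMap.range_eq_top.2 hsurj
  rw [h3, finrank_top] at h2
  have heq := Submodule.eq_of_le_of_finrank_eq hle (by omega)
  have : v ∈ LinearMap.range (D : F →ₗ[ℝ] E) := by
    rw [heq]
    exact hv
  exact this

end SliceCharts

/-! ### The Lorentzian inner product -/

section LorentzAlgebra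

lemma lorentz_comm (v w : R51) : lorentz v w = lorentz w v := by
  simp only [lorentz]; ring

/-- The `i`-th coordinate functional. -/
def coordL (i : Fin 5) : R51 →L[ℝ] ℝ := ContinuousLinearMap.proj i

/-- The Lorentzian inner product as a continuous bilinear map. -/
def lorentzL : R51 →L[ℝ] R51 →L[ℝ] ℝ :=
  -((coordL 0).smulRight (coordL 0)) + (coordL 1).smulRight (coordL 1) +
    (coordL 2).smulRight (coordL 2) + (coordL 3).smulRight (coordL 3) +
    (coordL 4).smulRight (coordL 4)

lemma lorentzL_apply (v w : R51) : lorentzL v w = lorentz v w := by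
  simp [lorentzL, lorentz, coordL]

lemma lorentz_add_left (u v w : R51) : lorentz (u + v) w = lorentz u w + lorentz v w := by
  simp only [← lorentzL_apply, map_add, add_apply]

lemma lorentz_sub_left (u v w : R51) : lorentz (u - v) w = lorentz u w - lorentz v w := by
  simp only [← lorentzL_apply, map_sub, sub_apply]

lemma lorentz_smul_left (c : ℝ) (v w : R51) : lorentz (c • v) w = c * lorentz v w := by
  simp only [← lorentzL_apply, map_smul, smul_apply, smul_eq_mul]

lemma lorentz_add_right (u v w : R51) : lorentz u (v + w) = lorentz u v + lorentz u w := by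
  simp only [← lorentzL_apply, map_add]

lemma lorentz_sub_right (u v w : R51) : lorentz u (v - w) = lorentz u v - lorentz u w := by
  simp only [← lorentzL_apply, map_sub]

lemma lorentz_smul_right (c : ℝ) (v w : R51) : lorentz v (c • w) = c * lorentz v w := by
  simp only [← lorentzL_apply, map_smul, smul_eq_mul]

lemma lorentz_zero_right (v : R51) : lorentz v 0 = 0 := by
  simp [lorentz]

lemma lorentz_zero_left (v : R51) : lorentz 0 v = 0 := by
  simp [lorentz]

lemma lorentz_neg_left (v w : R51) : lorentz (-v) w = -lorentz v w := by
  simp only [← lorentzL_apply, map_neg, neg_apply]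

lemma lorentz_neg_right (v w : R51) : lorentz v (-w) = -lorentz v w := by
  simp only [← lorentzL_apply, map_neg]

lemma lorentz_sum_right {ι : Type*} (s : Finset ι) (v : R51) (w : ι → R51) :
    lorentz v (∑ i ∈ s, w i) = ∑ i ∈ s, lorentz v (w i) := by
  simp only [← lorentzL_apply, map_sum]

lemma eq_zero_of_forall_lorentz {v : R51} (h : ∀ u, lorentz v u = 0) : v = 0 := by
  funext i
  have := h (Pi.single i 1)
  fin_cases i <;> simpa [lorentz, Pi.single_apply] using this

lemma lorentz_self_nonneg_of_zero {x : R51} (h0 : x 0 = 0) : 0 ≤ lorentz x x := by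
  simp only [lorentz, h0]
  nlinarith [mul_self_nonneg (x 1), mul_self_nonneg (x 2), mul_self_nonneg (x 3),
    mul_self_nonneg (x 4)]

lemma eq_zero_of_lorentz_self {x : R51} (h0 : x 0 = 0) (h : lorentz x x = 0) : x = 0 := by
  simp only [lorentz, h0] at h
  have h1 := mul_self_nonneg (x 1)
  have h2 := mul_self_nonneg (x 2)
  have h3 := mul_self_nonneg (x 3)
  have h4 := mul_self_nonneg (x 4)
  funext i
  fin_cases i
  · exact h0
  · exact mul_self_eq_zero.1 (by linarith : x 1 * x 1 = 0)
  · exact mul_self_eq_zero.1 (by linarith : x 2 * x 2 = 0)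
  · exact mul_self_eq_zero.1 (by linarith : x 3 * x 3 = 0)
  · exact mul_self_eq_zero.1 (by linarith : x 4 * x 4 = 0)

/-- The orthogonal complement of a timelike vector is spacelike. -/
lemma lorentz_self_pos_of_timelike {w W : R51} (hw : lorentz w w < 0) (hwW : lorentz w W = 0)
    (hW : W ≠ 0) : 0 < lorentz W W := by
  by_cases h0 : W 0 = 0
  · exact lt_of_le_of_ne (lorentz_self_nonneg_of_zero h0)
      fun h => hW (eq_zero_of_lorentz_self h0 h.symm)
  · have h1 : 0 ≤ lorentz (W 0 • w - w 0 • W) (W 0 • w - w 0 • W) :=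
      lorentz_self_nonneg_of_zero (by simp; ring)
    simp only [lorentz_sub_left, lorentz_sub_right, lorentz_smul_left, lorentz_smul_right,
      lorentz_comm W w, hwW] at h1
    have h2 : 0 < W 0 * W 0 := mul_self_pos.2 h0
    have h3 : W 0 * W 0 * lorentz w w < 0 := mul_neg_of_pos_of_neg h2 hw
    by_contra hcon
    push Not at hcon
    nlinarith [mul_nonneg (mul_self_nonneg (w 0)) (neg_nonneg.2 hcon)]

/-- A totally null subspace of Minkowski space has dimension at most one. -/
lemma exists_smul_of_null {u v : R51} (hu : lorentz u u = 0) (hv : lorentz v v = 0)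
    (huv : lorentz u v = 0) : ∃ (x : R51) (p q : ℝ), u = p • x ∧ v = q • x := by
  by_cases h0 : u 0 = 0
  · exact ⟨v, 0, 1, by simpa using eq_zero_of_lorentz_self h0 hu, by simp⟩
  · have h1 : v 0 • u - u 0 • v = 0 := by
      apply eq_zero_of_lorentz_self
      · simp; ring
      · simp [lorentz_sub_left, lorentz_sub_right, lorentz_smul_left, lorentz_smul_right,
          lorentz_comm v u, hu, hv, huv]
    refine ⟨u, 1, v 0 / u 0, by simp, ?_⟩
    have h2 := sub_eq_zero.1 h1
    rw [div_eq_inv_mul, mul_smul, h2, smul_smul, inv_mul_cancel₀ h0, one_smul]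

end LorentzAlgebra

section LorentzCalculus

variable {E : Type*} [NormedAddCommGroup E] [NormedSpace ℝ E]

lemma _root_.HasFDerivAt.lorentz {f h : E → R51} {f' h' : E →L[ℝ] R51} {x : E}
    (hf : HasFDerivAt f f' x) (hh : HasFDerivAt h h' x) :
    HasFDerivAt (fun y => lorentz (f y) (h y))
      ((lorentzL (f x)).comp h' + (lorentzL.flip (h x)).comp f') x := by
  have := lorentzL.hasFDerivAt_of_bilinear hf hh
  simp only [lorentzL_apply] at this
  refine this.congr_fderiv ?_
  ext X
  simp

lemma _root_.ContDiffOn.lorentz {f h : E → R51} {s : Set E} {n : WithTop ℕ∞}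
    (hf : ContDiffOn ℝ n f s) (hh : ContDiffOn ℝ n h s) :
    ContDiffOn ℝ n (fun y => lorentz (f y) (h y)) s := by
  simp only [← lorentzL_apply]
  exact (lorentzL.contDiff.comp_contDiffOn hf).clm_apply hh

lemma continuous_lorentz : Continuous fun p : R51 × R51 => lorentz p.1 p.2 := by
  unfold lorentz
  fun_prop

end LorentzCalculus

lemma isOpen_disc : IsOpen disc := Metric.isOpen_ball

lemma zero_mem_disc : (0 : ℂ) ∈ disc := by simp [disc]

/-- Continuous maps on the disc which agree off the origin agree at the origin. -/
lemma eq_zero_of_eqOn_ne {Y : Type*} [TopologicalSpace Y] [T2Space Y] {u v : ℂ → Y}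
    (hu : ContinuousOn u disc) (hv : ContinuousOn v disc)
    (h : ∀ z ∈ disc, z ≠ 0 → u z = v z) : u 0 = v 0 := by
  have hnhds := isOpen_disc.mem_nhds zero_mem_disc
  have h1 := (hu.continuousAt hnhds).tendsto.mono_left (nhdsWithin_le_nhds (s := {0}ᶜ))
  have h2 := (hv.continuousAt hnhds).tendsto.mono_left (nhdsWithin_le_nhds (s := {0}ᶜ))
  refine tendsto_nhds_unique (h1.congr' ?_) h2
  filter_upwards [self_mem_nhdsWithin, nhdsWithin_le_nhds hnhds] with z hz hz'
  exact h z hz' hz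

/-! ### Shape operators of conformal maps -/

section ShapeOperator

variable {V : Type*} [NormedAddCommGroup V] [NormedSpace ℝ V] {ι : Type*} [Fintype ι]
  [DecidableEq ι]

lemma trace_shapeOperator (b : Module.Basis ι ℝ V) (f : V → R51) (a : V) (ν : R51) :
    LinearMap.trace ℝ V (shapeOperator b f a ν) =
      ((Matrix.of fun i j => firstForm f a (b i) (b j))⁻¹ *
        Matrix.of fun i j => secondForm f a ν (b i) (b j)).trace := by
  rw [LinearMap.trace_eq_matrix_trace ℝ b, shapeOperator, LinearMap.toMatrix_toLin]

lemma det_shapeOperator (b : Module.Basis ι ℝ V) (f : V → R51) (a : V) (ν : R51) :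
    LinearMap.det (shapeOperator b f a ν) =
      ((Matrix.of fun i j => firstForm f a (b i) (b j))⁻¹ *
        Matrix.of fun i j => secondForm f a ν (b i) (b j)).det := by
  rw [shapeOperator, LinearMap.det_toLin]

end ShapeOperator

lemma inv_gram_of_conformal {g : ℂ → R51} {z : ℂ} {E : ℝ}
    (h : ∀ X Y : ℂ, firstForm g z X Y = E * inner ℝ X Y) :
    (Matrix.of fun i j => firstForm g z (Complex.basisOneI i) (Complex.basisOneI j))⁻¹ =
      E⁻¹ • (1 : Matrix (Fin 2) (Fin 2) ℝ) := by
  have h1 : (Matrix.of fun i j => firstForm g z (Complex.basisOneI i) (Complex.basisOneI j)) =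
      E • (1 : Matrix (Fin 2) (Fin 2) ℝ) := by
    ext i j
    fin_cases i <;> fin_cases j <;> simp [h, Complex.inner]
  rw [h1]
  -- For `E = 0` both sides are zero, since the inverse of the zero matrix and `0⁻¹` are zero by
  -- convention.
  rcases eq_or_ne E 0 with rfl | hE
  · simp
  · have : Invertible E := invertibleOfNonzero hE
    rw [Matrix.inv_smul _ _ (by simp)]
    simp

lemma trace_surfaceShape {g : ℂ → R51} {z : ℂ} {E : ℝ} (ν : R51)
    (h : ∀ X Y : ℂ, firstForm g z X Y = E * inner ℝ X Y) :
    LinearMap.trace ℝ ℂ (surfaceShape g z ν) =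
      E⁻¹ * (secondForm g z ν 1 1 + secondForm g z ν Complex.I Complex.I) := by
  rw [surfaceShape, trace_shapeOperator, inv_gram_of_conformal h]
  simp [Matrix.trace_fin_two]
  ring

lemma det_surfaceShape {g : ℂ → R51} {z : ℂ} {E : ℝ} (ν : R51)
    (h : ∀ X Y : ℂ, firstForm g z X Y = E * inner ℝ X Y) :
    LinearMap.det (surfaceShape g z ν) =
      E⁻¹ ^ 2 * (secondForm g z ν 1 1 * secondForm g z ν Complex.I Complex.I -
        secondForm g z ν 1 Complex.I * secondForm g z ν Complex.I 1) := by
  rw [surfaceShape, det_shapeOperator, inv_gram_of_conformal h]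
  simp [Matrix.det_fin_two]
  ring

/-! ### Conformality relations and the harmonic map equation -/

namespace IsBranchedStationary

variable {g : ℂ → R51} {m : ℕ} (hg : IsBranchedStationary g m) {z : ℂ}
include hg

lemma differentiableAt (hz : z ∈ disc) : DifferentiableAt ℝ g z :=
  (hg.smooth.contDiffAt (isOpen_disc.mem_nhds hz)).differentiableAt (by simp)

lemma contDiffOn_fderiv : ContDiffOn ℝ ∞ (fderiv ℝ g) disc :=
  ((contDiffOn_infty_iff_fderiv_of_isOpen isOpen_disc).1 hg.smooth).2

lemma contDiffOn_fderiv_apply (X : ℂ) : ContDiffOn ℝ ∞ (fun z => fderiv ℝ g z X) disc :=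
  hg.contDiffOn_fderiv.clm_apply contDiffOn_const

lemma differentiableAt_fderiv (hz : z ∈ disc) : DifferentiableAt ℝ (fderiv ℝ g) z :=
  (hg.contDiffOn_fderiv.contDiffAt (isOpen_disc.mem_nhds hz)).differentiableAt (by simp)

lemma hasFDerivAt_fderiv_apply (hz : z ∈ disc) (X : ℂ) :
    HasFDerivAt (fun z => fderiv ℝ g z X) ((fderiv ℝ (fderiv ℝ g) z).flip X) z :=
  ((ContinuousLinearMap.apply ℝ R51 X).hasFDerivAt (x := fderiv ℝ g z)).comp z
    (hg.differentiableAt_fderiv hz).hasFDerivAt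

lemma lorentz_fderiv_self (hz : z ∈ disc) (X : ℂ) : lorentz (fderiv ℝ g z X) (g z) = 0 := by
  have h1 := (hg.differentiableAt hz).hasFDerivAt.lorentz (hg.differentiableAt hz).hasFDerivAt
  have h2 : HasFDerivAt (fun y => lorentz (g y) (g y)) (0 : ℂ →L[ℝ] ℝ) z := by
    refine (hasFDerivAt_const (1 : ℝ) z).congr_of_eventuallyEq ?_
    filter_upwards [isOpen_disc.mem_nhds hz] with y hy
    exact hg.mem_deSitter y hy
  have h3 := congrArg (fun T : ℂ →L[ℝ] ℝ => T X) (h1.unique h2)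
  simp [lorentzL_apply, lorentz_comm (g z)] at h3
  linarith

lemma lorentz_fderiv_fderiv_self (hz : z ∈ disc) (X Y : ℂ) :
    lorentz (fderiv ℝ (fderiv ℝ g) z X Y) (g z) = -firstForm g z X Y := by
  have h1 := (hg.hasFDerivAt_fderiv_apply hz Y).lorentz (hg.differentiableAt hz).hasFDerivAt
  have h2 : HasFDerivAt (fun y => lorentz (fderiv ℝ g y Y) (g y)) (0 : ℂ →L[ℝ] ℝ) z := by
    refine (hasFDerivAt_const (0 : ℝ) z).congr_of_eventuallyEq ?_
    filter_upwards [isOpen_disc.mem_nhds hz] with y hy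
    exact hg.lorentz_fderiv_self hy Y
  have h3 := congrArg (fun T : ℂ →L[ℝ] ℝ => T X) (h1.unique h2)
  simp only [add_apply, ContinuousLinearMap.comp_apply, lorentzL_apply,
    ContinuousLinearMap.flip_apply, zero_apply] at h3
  rw [firstForm, lorentz_comm (fderiv ℝ g z X)]
  linarith

lemma firstForm_one_I (hz : z ∈ disc) : firstForm g z 1 Complex.I = 0 := by
  obtain ⟨E, -, hE⟩ := hg.conformal
  simp [(hE z hz).2]

lemma firstForm_I_I (hz : z ∈ disc) : firstForm g z Complex.I Complex.I = firstForm g z 1 1 := by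
  obtain ⟨E, -, hE⟩ := hg.conformal
  simp [(hE z hz).2]

lemma firstForm_eq (hz : z ∈ disc) (X Y : ℂ) :
    firstForm g z X Y = firstForm g z 1 1 * inner ℝ X Y := by
  obtain ⟨E, -, hE⟩ := hg.conformal
  simp [(hE z hz).2, Complex.inner]

lemma firstForm_one_one_nonneg (hz : z ∈ disc) : 0 ≤ firstForm g z 1 1 := by
  obtain ⟨E, -, hE⟩ := hg.conformal
  simpa [(hE z hz).2, Complex.inner] using (hE z hz).1

/-- Conformality alone gives `E ≥ 0`. If `E = 0`, then `g_x` and `g_y` span a totally null space and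
are proportional, against injectivity of the differential. -/
lemma firstForm_one_one_pos (hz : z ∈ disc) (hz0 : z ≠ 0) : 0 < firstForm g z 1 1 := by
  refine lt_of_le_of_ne (hg.firstForm_one_one_nonneg hz) fun h => ?_
  obtain ⟨x, p, q, hp, hq⟩ := exists_smul_of_null (u := fderiv ℝ g z 1)
    (v := fderiv ℝ g z Complex.I) h.symm ((hg.firstForm_I_I hz).trans h.symm)
    (hg.firstForm_one_I hz)
  have hinj := (injective_iff_map_eq_zero _).1 (hg.regular z hz hz0)
  have h1 : fderiv ℝ g z (q • 1 - p • Complex.I) = 0 := by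
    rw [map_sub, map_smul, map_smul, hp, hq, smul_smul, smul_smul, mul_comm, sub_self]
  have h2 := hinj _ h1
  have h3 := congrArg Complex.im h2
  simp at h3
  have h4 : fderiv ℝ g z 1 = 0 := by rw [hp, h3, zero_smul]
  exact one_ne_zero (hinj _ h4)

lemma fderiv_fderiv_symm (hz : z ∈ disc) (X Y : ℂ) :
    fderiv ℝ (fderiv ℝ g) z X Y = fderiv ℝ (fderiv ℝ g) z Y X :=
  (hg.smooth.contDiffAt (isOpen_disc.mem_nhds hz)).isSymmSndFDerivAt (by
    simpa using (WithTop.coe_le_coe.2 le_top : ((2 : ℕ∞) : WithTop ℕ∞) ≤ ((⊤ : ℕ∞) : WithTop ℕ∞)))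
    X Y

/-- The coordinate Laplacian is normal to the surface. -/
lemma lorentz_laplacian_fderiv (hz : z ∈ disc) (X : ℂ) :
    lorentz (fderiv ℝ (fderiv ℝ g) z 1 1 + fderiv ℝ (fderiv ℝ g) z Complex.I Complex.I)
      (fderiv ℝ g z X) = 0 := by
  have hsymm := hg.fderiv_fderiv_symm hz 1 Complex.I
  have hd := fun X => hg.hasFDerivAt_fderiv_apply hz X
  -- The claim is a combination of first derivatives of the two conformality relations `⟨g_x, g_y⟩ =
  -- 0` and `⟨g_x, g_x⟩ = ⟨g_y, g_y⟩`.
  have h1 : HasFDerivAt (fun y => firstForm g y 1 Complex.I) (0 : ℂ →L[ℝ] ℝ) z := by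
    refine (hasFDerivAt_const (0 : ℝ) z).congr_of_eventuallyEq ?_
    filter_upwards [isOpen_disc.mem_nhds hz] with y hy
    exact hg.firstForm_one_I hy
  have h2 : HasFDerivAt (fun y => firstForm g y 1 1 - firstForm g y Complex.I Complex.I)
      (0 : ℂ →L[ℝ] ℝ) z := by
    refine (hasFDerivAt_const (0 : ℝ) z).congr_of_eventuallyEq ?_
    filter_upwards [isOpen_disc.mem_nhds hz] with y hy
    simp [hg.firstForm_I_I hy]
  have h3 := ((hd 1).lorentz (hd Complex.I)).unique h1
  have h4 := (((hd 1).lorentz (hd 1)).sub ((hd Complex.I).lorentz (hd Complex.I))).unique h2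
  have h31 := congrArg (fun T : ℂ →L[ℝ] ℝ => T 1) h3
  have h3I := congrArg (fun T : ℂ →L[ℝ] ℝ => T Complex.I) h3
  have h41 := congrArg (fun T : ℂ →L[ℝ] ℝ => T 1) h4
  have h4I := congrArg (fun T : ℂ →L[ℝ] ℝ => T Complex.I) h4
  simp only [add_apply, sub_apply, ContinuousLinearMap.comp_apply, lorentzL_apply,
    ContinuousLinearMap.flip_apply, zero_apply,
    lorentz_comm (fderiv ℝ g z 1), lorentz_comm (fderiv ℝ g z Complex.I), hsymm]
    at h31 h3I h41 h4I
  have hX : fderiv ℝ g z X = X.re • fderiv ℝ g z 1 + X.im • fderiv ℝ g z Complex.I := by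
    rw [← map_smul, ← map_smul, ← map_add]
    simp
  rw [hX, lorentz_add_right, lorentz_smul_right, lorentz_smul_right, lorentz_add_left,
    lorentz_add_left]
  linear_combination X.re * (h41 / 2 + h3I) + X.im * (h31 - h4I / 2)

/-- The harmonic map equation off the branch point. -/
lemma laplacian_eq_of_ne (hz : z ∈ disc) (hz0 : z ≠ 0) :
    fderiv ℝ (fderiv ℝ g) z 1 1 + fderiv ℝ (fderiv ℝ g) z Complex.I Complex.I =
      (-(2 * firstForm g z 1 1)) • g z := by
  set E := firstForm g z 1 1 with hE
  set Δ := fderiv ℝ (fderiv ℝ g) z 1 1 + fderiv ℝ (fderiv ℝ g) z Complex.I Complex.I with hΔ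
  have hEpos : 0 < E := hg.firstForm_one_one_pos hz hz0
  have hEE := mul_inv_cancel₀ hEpos.ne'
  have hgg : lorentz (g z) (g z) = 1 := hg.mem_deSitter z hz
  have h11 : lorentz (fderiv ℝ g z 1) (fderiv ℝ g z 1) = E := rfl
  have h1I : lorentz (fderiv ℝ g z 1) (fderiv ℝ g z Complex.I) = 0 := hg.firstForm_one_I hz
  have hII : lorentz (fderiv ℝ g z Complex.I) (fderiv ℝ g z Complex.I) = E := hg.firstForm_I_I hz
  have h1g := hg.lorentz_fderiv_self hz 1
  have hIg := hg.lorentz_fderiv_self hz Complex.I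
  have hΔ1 := hg.lorentz_laplacian_fderiv hz 1
  have hΔI := hg.lorentz_laplacian_fderiv hz Complex.I
  have hΔg : lorentz Δ (g z) = -(2 * E) := by
    rw [hΔ, lorentz_add_left, hg.lorentz_fderiv_fderiv_self hz,
      hg.lorentz_fderiv_fderiv_self hz, hg.firstForm_I_I hz]
    ring
  rw [← hΔ] at hΔ1 hΔI
  rw [← sub_eq_zero]
  refine eq_zero_of_forall_lorentz fun u => ?_
  -- The test vector `u` is split into its components along `g`, `g_x`, `g_y` and a remainder `ν`
  -- normal to the surface in de Sitter space; stationarity handles `ν`.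
  set ν := u - lorentz u (g z) • g z - (E⁻¹ * lorentz u (fderiv ℝ g z 1)) • fderiv ℝ g z 1 -
    (E⁻¹ * lorentz u (fderiv ℝ g z Complex.I)) • fderiv ℝ g z Complex.I with hν
  have hνg : lorentz ν (g z) = 0 := by
    simp only [hν, lorentz_sub_left, lorentz_smul_left, hgg, h1g, hIg]
    ring
  have hν1 : lorentz ν (fderiv ℝ g z 1) = 0 := by
    simp only [hν, lorentz_sub_left, lorentz_smul_left, lorentz_comm (g z), h1g, h11,
      lorentz_comm (fderiv ℝ g z Complex.I) (fderiv ℝ g z 1), h1I]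
    linear_combination (-lorentz u (fderiv ℝ g z 1)) * hEE
  have hνI : lorentz ν (fderiv ℝ g z Complex.I) = 0 := by
    simp only [hν, lorentz_sub_left, lorentz_smul_left, lorentz_comm (g z), hIg, hII, h1I]
    linear_combination (-lorentz u (fderiv ℝ g z Complex.I)) * hEE
  have hstat := hg.stationary z hz hz0 ν hνg fun X => by
    have hX : fderiv ℝ g z X = X.re • fderiv ℝ g z 1 + X.im • fderiv ℝ g z Complex.I := by
      rw [← map_smul, ← map_smul, ← map_add]
      simp
    rw [hX, lorentz_add_right, lorentz_smul_right, lorentz_smul_right, hν1, hνI]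
    ring
  rw [trace_surfaceShape ν (hg.firstForm_eq hz), secondForm, secondForm, ← lorentz_add_left,
    mul_eq_zero, or_iff_right (inv_ne_zero hEpos.ne')] at hstat
  have hu : u = ν + lorentz u (g z) • g z + (E⁻¹ * lorentz u (fderiv ℝ g z 1)) • fderiv ℝ g z 1 +
    (E⁻¹ * lorentz u (fderiv ℝ g z Complex.I)) • fderiv ℝ g z Complex.I := by
    rw [hν]; abel
  rw [hu]
  generalize lorentz u (g z) = c1
  generalize E⁻¹ * lorentz u (fderiv ℝ g z 1) = c2
  generalize E⁻¹ * lorentz u (fderiv ℝ g z Complex.I) = c3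
  simp only [lorentz_sub_left, lorentz_add_right, lorentz_smul_right, lorentz_smul_left,
    hΔ1, hΔI, hΔg, hgg, lorentz_comm (g z), hνg, h1g, hIg]
  rw [← hΔ] at hstat
  rw [hstat]
  ring

lemma laplacian_eq (hz : z ∈ disc) :
    fderiv ℝ (fderiv ℝ g) z 1 1 + fderiv ℝ (fderiv ℝ g) z Complex.I Complex.I =
      (-(2 * firstForm g z 1 1)) • g z := by
  rcases eq_or_ne z 0 with rfl | hz0
  · have hd2 : ContinuousOn (fderiv ℝ (fderiv ℝ g)) disc :=
      hg.contDiffOn_fderiv.continuousOn_fderiv_of_isOpen isOpen_disc (by simp)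
    refine eq_zero_of_eqOn_ne
      (u := fun z => fderiv ℝ (fderiv ℝ g) z 1 1 + fderiv ℝ (fderiv ℝ g) z Complex.I Complex.I)
      (v := fun z => (-(2 * firstForm g z 1 1)) • g z) ?_ ?_
      fun z hz hz0 => hg.laplacian_eq_of_ne hz hz0
    · exact ((hd2.clm_apply continuousOn_const).clm_apply continuousOn_const).add
        ((hd2.clm_apply continuousOn_const).clm_apply continuousOn_const)
    · exact (continuousOn_const.mul ((hg.contDiffOn_fderiv_apply 1).lorentz
        (hg.contDiffOn_fderiv_apply 1)).continuousOn).neg.smul hg.smooth.continuousOn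
  · exact hg.laplacian_eq_of_ne hz hz0

end IsBranchedStationary

/-! ### The complex derivative and its `∂̄`-system -/

/-- The componentwise real part. -/
def reV : (Fin 5 → ℂ) →L[ℝ] R51 :=
  ContinuousLinearMap.pi fun i => Complex.reCLM.comp (ContinuousLinearMap.proj i)

/-- The componentwise imaginary part. -/
def imV : (Fin 5 → ℂ) →L[ℝ] R51 :=
  ContinuousLinearMap.pi fun i => Complex.imCLM.comp (ContinuousLinearMap.proj i)

@[simp] lemma reV_apply (u : Fin 5 → ℂ) (i : Fin 5) : reV u i = (u i).re := rfl

@[simp] lemma imV_apply (u : Fin 5 → ℂ) (i : Fin 5) : imV u i = (u i).im := rfl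

lemma reV_smul (c : ℂ) (u : Fin 5 → ℂ) : reV (c • u) = c.re • reV u - c.im • imV u := by
  ext i
  simp

lemma imV_smul (c : ℂ) (u : Fin 5 → ℂ) : imV (c • u) = c.re • imV u + c.im • reV u := by
  ext i
  simp

lemma norm_reV_le (u : Fin 5 → ℂ) : ‖reV u‖ ≤ ‖u‖ :=
  (pi_norm_le_iff_of_nonneg (norm_nonneg u)).2 fun i =>
    (Complex.abs_re_le_norm (u i)).trans (norm_le_pi_norm u i)

/-- The components of `g_x - i g_y`, which is twice the complex derivative of `g`. -/
def complexDeriv (g : ℂ → R51) (i : Fin 5) (z : ℂ) : ℂ :=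
  (fderiv ℝ g z 1 i : ℂ) - Complex.I * (fderiv ℝ g z Complex.I i : ℂ)

lemma fderiv_eq_reV (g : ℂ → R51) (z X : ℂ) :
    fderiv ℝ g z X = reV (X • fun i => complexDeriv g i z) := by
  have hX : fderiv ℝ g z X = X.re • fderiv ℝ g z 1 + X.im • fderiv ℝ g z Complex.I := by
    rw [← map_smul, ← map_smul, ← map_add]
    simp
  rw [hX]
  ext i
  simp [complexDeriv]

/-- The signs of the Lorentzian inner product. -/
def lorentzSign (i : Fin 5) : ℂ := if i = 0 then -1 else 1

/-- The coefficients of the linear `∂̄`-system solved by the complex derivative. -/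
def dbarCoeff (g : ℂ → R51) (i j : Fin 5) (z : ℂ) : ℂ :=
  -((g z i : ℂ) * (lorentzSign j * (starRingEnd ℂ) (complexDeriv g j z)))

/-- `q` is the quotient of the complex derivative of `g` by `z ^ k`. -/
structure IsDerivQuotient (g : ℂ → R51) (k : ℕ) (q : Fin 5 → ℂ → ℂ) : Prop where
  smooth : ∀ i, ContDiffOn ℝ ∞ (q i) disc
  complexDeriv_eq : ∀ i, ∀ z ∈ disc, complexDeriv g i z = z ^ k * q i z
  dbar : ∀ i, ∀ z ∈ disc, fderiv ℝ (q i) z 1 + Complex.I * fderiv ℝ (q i) z Complex.I =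
    ∑ j, dbarCoeff g i j z * q j z

lemma contDiffOn_ofReal_comp {f : ℂ → ℝ} (hf : ContDiffOn ℝ ∞ f disc) :
    ContDiffOn ℝ ∞ (fun z => (f z : ℂ)) disc :=
  Complex.ofRealCLM.contDiff.comp_contDiffOn hf

namespace IsBranchedStationary

variable {g : ℂ → R51} {m : ℕ} (hg : IsBranchedStationary g m)
include hg

lemma contDiffOn_complexDeriv (i : Fin 5) : ContDiffOn ℝ ∞ (complexDeriv g i) disc := by
  have h := fun X => contDiffOn_ofReal_comp (contDiffOn_pi.1 (hg.contDiffOn_fderiv_apply X) i)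
  exact (h 1).sub (contDiffOn_const.mul (h Complex.I))

lemma contDiffOn_dbarCoeff (i j : Fin 5) : ContDiffOn ℝ ∞ (dbarCoeff g i j) disc :=
  ((contDiffOn_ofReal_comp (contDiffOn_pi.1 hg.smooth i)).mul (contDiffOn_const.mul
    (Complex.conjCLE.contDiff.comp_contDiffOn (hg.contDiffOn_complexDeriv j)))).neg

lemma fderiv_complexDeriv {z : ℂ} (hz : z ∈ disc) (i : Fin 5) (X : ℂ) :
    fderiv ℝ (complexDeriv g i) z X = (fderiv ℝ (fderiv ℝ g) z X 1 i : ℂ) -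
      Complex.I * (fderiv ℝ (fderiv ℝ g) z X Complex.I i : ℂ) := by
  have h : ∀ Y, HasFDerivAt (fun z => (fderiv ℝ g z Y i : ℂ))
      (Complex.ofRealCLM.comp ((ContinuousLinearMap.proj i).comp
        ((fderiv ℝ (fderiv ℝ g) z).flip Y))) z := fun Y =>
    Complex.ofRealCLM.hasFDerivAt.comp z
      (hasFDerivAt_pi'.1 (hg.hasFDerivAt_fderiv_apply hz Y) i)
  have h2 := (h 1).sub ((h Complex.I).const_mul Complex.I)
  have h3 : HasFDerivAt (complexDeriv g i) _ z := h2
  rw [h3.fderiv]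
  simp

lemma sum_dbarCoeff_mul {z : ℂ} (hz : z ∈ disc) (i : Fin 5) :
    ∑ j, dbarCoeff g i j z * complexDeriv g j z =
      (((-(2 * firstForm g z 1 1)) • g z) i : ℝ) := by
  have h1 : ∀ j, dbarCoeff g i j z * complexDeriv g j z = -(g z i : ℂ) * (lorentzSign j *
      ((fderiv ℝ g z 1 j : ℂ) ^ 2 + (fderiv ℝ g z Complex.I j : ℂ) ^ 2)) := by
    intro j
    simp only [dbarCoeff, complexDeriv, map_sub, map_mul, Complex.conj_ofReal, Complex.conj_I]
    linear_combination (g z i : ℂ) * lorentzSign j * (fderiv ℝ g z Complex.I j : ℂ) ^ 2 *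
      Complex.I_sq
  have h2 : 2 * firstForm g z 1 1 = lorentz (fderiv ℝ g z 1) (fderiv ℝ g z 1) +
      lorentz (fderiv ℝ g z Complex.I) (fderiv ℝ g z Complex.I) := by
    have := hg.firstForm_I_I hz
    rw [firstForm] at this
    rw [this, firstForm]
    ring
  rw [h2]
  simp only [h1, Fin.sum_univ_five, lorentz, lorentzSign]
  simp
  ring

/-- The left side of the system is `Δg = -2E g`. The quadratic expression `2E` is made linear in the
complex derivative by placing its conjugate into the coefficients. -/
lemma isDerivQuotient_zero : IsDerivQuotient g 0 (complexDeriv g) where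
  smooth := hg.contDiffOn_complexDeriv
  complexDeriv_eq i z _ := by simp
  dbar i z hz := by
    have hsymm : fderiv ℝ (fderiv ℝ g) z 1 Complex.I = fderiv ℝ (fderiv ℝ g) z Complex.I 1 :=
      hg.fderiv_fderiv_symm hz 1 Complex.I
    rw [hg.sum_dbarCoeff_mul hz, ← hg.laplacian_eq hz, hg.fderiv_complexDeriv hz,
      hg.fderiv_complexDeriv hz, hsymm]
    simp only [Pi.add_apply, Complex.ofReal_add]
    linear_combination (-(fderiv ℝ (fderiv ℝ g) z Complex.I Complex.I i : ℂ)) * Complex.I_sq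

/-- The factor `z` is holomorphic, so it passes through `∂̄` and cancels off the origin; continuity
gives the system at the origin. -/
lemma exists_isDerivQuotient_succ {k : ℕ} {q : Fin 5 → ℂ → ℂ} (hq : IsDerivQuotient g k q)
    (h0 : ∀ i, q i 0 = 0) : ∃ q', IsDerivQuotient g (k + 1) q' := by
  obtain ⟨q', hs, hqq⟩ := exists_eq_mul_of_dbar one_pos hg.contDiffOn_dbarCoeff hq.smooth
    hq.dbar h0
  have hd : ∀ i, ∀ z ∈ disc, HasFDerivAt (q' i) (fderiv ℝ (q' i) z) z := fun i z hz =>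
    (((hs i).contDiffAt (isOpen_disc.mem_nhds hz)).differentiableAt (by simp)).hasFDerivAt
  have hmul : ∀ i, ∀ z ∈ disc, ∀ X, fderiv ℝ (q i) z X = z * fderiv ℝ (q' i) z X + X * q' i z := by
    intro i z hz X
    have h1 : HasFDerivAt (fun z => z * q' i z) _ z :=
      (hasFDerivAt_id (𝕜 := ℝ) z).mul (hd i z hz)
    have h2 : HasFDerivAt (q i) _ z := h1.congr_of_eventuallyEq (by
      filter_upwards [isOpen_disc.mem_nhds hz] with y hy
      exact hqq i y hy)
    rw [h2.fderiv]
    simp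
    ring
  have hne : ∀ i, ∀ z ∈ disc, z ≠ 0 → fderiv ℝ (q' i) z 1 + Complex.I *
      fderiv ℝ (q' i) z Complex.I = ∑ j, dbarCoeff g i j z * q' j z := by
    intro i z hz hz0
    have h1 := hq.dbar i z hz
    have h2 : ∑ j, dbarCoeff g i j z * q j z = z * ∑ j, dbarCoeff g i j z * q' j z := by
      rw [Finset.mul_sum]
      refine Finset.sum_congr rfl fun j _ => ?_
      rw [hqq j z hz]
      ring
    rw [h2, hmul i z hz, hmul i z hz] at h1
    apply mul_left_cancel₀ hz0
    linear_combination h1 - q' i z * Complex.I_sq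
  refine ⟨q', hs, fun i z hz => ?_, fun i z hz => ?_⟩
  · rw [hq.complexDeriv_eq i z hz, hqq i z hz]
    ring
  · rcases eq_or_ne z 0 with rfl | hz0
    · have hc : ∀ X, ContinuousOn (fun z => fderiv ℝ (q' i) z X) disc := fun X =>
        ((hs i).continuousOn_fderiv_of_isOpen isOpen_disc (by simp)).clm_apply continuousOn_const
      refine eq_zero_of_eqOn_ne
        (u := fun z => fderiv ℝ (q' i) z 1 + Complex.I * fderiv ℝ (q' i) z Complex.I)
        (v := fun z => ∑ j, dbarCoeff g i j z * q' j z) ?_ ?_ (hne i)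
      · exact (hc 1).add (continuousOn_const.mul (hc _))
      · exact continuousOn_finsetSum _ fun j _ =>
          (hg.contDiffOn_dbarCoeff i j).continuousOn.mul (hs j).continuousOn
    · exact hne i z hz hz0

/-- The leading term of `g` at the origin. -/
lemma sub_leading_isBigO {k : ℕ} {q : Fin 5 → ℂ → ℂ} (hq : IsDerivQuotient g k q) :
    (fun z => g z - g 0 - (1 / (k + 1 : ℝ)) • reV (z ^ (k + 1) • fun i => q i 0))
      =O[𝓝 0] fun z => ‖z‖ ^ (k + 2) := by
  set ψ : ℂ → Fin 5 → ℂ := fun z i => q i z with hψ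
  have hψd : DifferentiableAt ℝ ψ 0 := by
    refine differentiableAt_pi.2 fun i => ?_
    exact ((hq.smooth i).contDiffAt (isOpen_disc.mem_nhds zero_mem_disc)).differentiableAt (by simp)
  have hO : (fun z => ψ z - ψ 0) =O[𝓝 0] fun z => z - 0 := hψd.isBigO_sub
  obtain ⟨C, hC⟩ := hO.bound
  obtain ⟨δ, hδ, hball⟩ := Metric.eventually_nhds_iff_ball.1
    (hC.and (isOpen_disc.mem_nhds zero_mem_disc))
  set h : ℂ → R51 := fun z => g z - g 0 - (1 / (k + 1 : ℝ)) • reV (z ^ (k + 1) • ψ 0) with hh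
  -- The differential of the remainder is `X ↦ Re(z ^ k X (ψ z - ψ 0))`, of size `O(|z|^(k+1))`; the
  -- mean value inequality on the closed ball of radius `|z|` adds one order.
  have hd : ∀ z ∈ disc, HasFDerivAt h (fderiv ℝ h z) z ∧
      ∀ X, fderiv ℝ h z X = reV ((z ^ k * X) • (ψ z - ψ 0)) := by
    intro z hz
    have h1 := (hg.differentiableAt hz).hasFDerivAt
    have h2 : HasFDerivAt (fun z : ℂ => z ^ (k + 1)) _ z :=
      ((hasDerivAt_pow (k + 1) z).hasFDerivAt).restrictScalars ℝ
    have h3 := reV.hasFDerivAt.comp z (h2.smul_const (ψ 0))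
    have h4 : HasFDerivAt h _ z := (h1.sub_const (g 0)).sub (h3.const_smul (1 / (k + 1 : ℝ)))
    refine ⟨h4.differentiableAt.hasFDerivAt, fun X => ?_⟩
    rw [h4.fderiv]
    simp only [sub_apply, smul_apply, ContinuousLinearMap.comp_apply]
    rw [fderiv_eq_reV]
    have h5 : (fun i => complexDeriv g i z) = z ^ k • ψ z := by
      ext i
      simp [hψ, hq.complexDeriv_eq i z hz]
    have h6 : (0 : ℝ) < k + 1 := by positivity
    rw [h5, ← map_smul, ← map_sub]
    congr 1
    ext i
    simp
    field_simp
  refine IsBigO.of_bound C ?_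
  filter_upwards [Metric.ball_mem_nhds (0 : ℂ) hδ] with z hz
  have hz' : ‖z‖ < δ := by simpa using hz
  have hsub : ∀ y ∈ Metric.closedBall (0 : ℂ) ‖z‖, y ∈ Metric.ball (0 : ℂ) δ := fun y hy =>
    Metric.closedBall_subset_ball hz' hy
  have hbound : ∀ y ∈ Metric.closedBall (0 : ℂ) ‖z‖, ‖fderiv ℝ h y‖ ≤ C * ‖z‖ ^ (k + 1) := by
    intro y hy
    have hyz : ‖y‖ ≤ ‖z‖ := by simpa using hy
    have h1 := (hball y (hsub y hy)).1
    rw [sub_zero] at h1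
    have hCy : 0 ≤ C * ‖y‖ := (norm_nonneg _).trans h1
    have hCz : C * ‖y‖ ^ (k + 1) ≤ C * ‖z‖ ^ (k + 1) := by
      -- The sign of `C` is not known; if it is negative, the bounds force `y = z = 0`.
      rcases le_or_gt 0 C with hC0 | hC0
      · gcongr
      · have : ‖y‖ = 0 := le_antisymm (by nlinarith) (norm_nonneg y)
        have h2 := (hball z hz).1
        rw [sub_zero] at h2
        have h3 : 0 ≤ C * ‖z‖ := (norm_nonneg _).trans h2
        have h4 : ‖z‖ = 0 := le_antisymm (by nlinarith) (norm_nonneg z)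
        rw [this, h4]
    refine ContinuousLinearMap.opNorm_le_bound _ ?_ fun X => ?_
    · refine le_trans ?_ hCz
      rw [pow_succ']
      rw [← mul_assoc]
      positivity
    · rw [(hd y (hball y (hsub y hy)).2).2 X]
      refine (norm_reV_le _).trans ?_
      rw [norm_smul, norm_mul, norm_pow]
      calc ‖y‖ ^ k * ‖X‖ * ‖ψ y - ψ 0‖ ≤ ‖y‖ ^ k * ‖X‖ * (C * ‖y‖) := by gcongr
        _ = C * ‖y‖ ^ (k + 1) * ‖X‖ := by ring
        _ ≤ C * ‖z‖ ^ (k + 1) * ‖X‖ := by gcongr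
  have hmv := (convex_closedBall (0 : ℂ) ‖z‖).norm_image_sub_le_of_norm_hasFDerivWithin_le
    (f := h) (f' := fderiv ℝ h)
    (fun y hy => ((hd y (hball y (hsub y hy)).2).1).hasFDerivWithinAt) hbound
    (Metric.mem_closedBall_self (norm_nonneg z)) (by simp : z ∈ Metric.closedBall (0 : ℂ) ‖z‖)
  have h00 : h 0 = 0 := by simp [hh]
  rw [h00, sub_zero, sub_zero] at hmv
  refine hmv.trans (le_of_eq ?_)
  simp
  ring

end IsBranchedStationary

/-! ### The order of vanishing at the branch point -/

lemma pow_norm_isBigO_of_le {k n : ℕ} (h : k ≤ n) :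
    (fun z : ℂ => ‖z‖ ^ n) =O[𝓝 0] fun z : ℂ => ‖z‖ ^ k := by
  refine IsBigO.of_bound 1 ?_
  filter_upwards [Metric.ball_mem_nhds (0 : ℂ) one_pos] with z hz
  have hz' : ‖z‖ < 1 := by simpa using hz
  rw [norm_pow, norm_pow, norm_norm, one_mul]
  exact pow_le_pow_of_le_one (norm_nonneg z) hz'.le h

/-- Moves the branch estimates from the chart variable `ζ = φ z` to `z`, where `φ z = O(|z|)`. -/
lemma IsBranchPoint.exists_chart {g : ℂ → R51} {m : ℕ} (hb : IsBranchPoint g 0 m)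
    (hgc : ContinuousAt g 0) (hgS : ∀ᶠ z in 𝓝 0, g z ∈ deSitter) :
    ∃ (φ : ℂ → ℂ) (Λ : ℂ →L[ℝ] ℂ)
      (χ : OpenPartialHomeomorph R51 ((ℂ × EuclideanSpace ℝ (Fin 2)) × ℝ)),
      φ 0 = 0 ∧ HasFDerivAt φ Λ 0 ∧ Function.Surjective Λ ∧ IsSmoothChart χ ∧ g 0 ∈ χ.source ∧
      χ (g 0) = 0 ∧
      (fun z => (χ (g z)).1.1 - φ z ^ (m + 1)) =O[𝓝 0] (fun z => ‖z‖ ^ (m + 2)) ∧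
      (fun z => χ (g z)) =O[𝓝 0] (fun z => ‖z‖ ^ (m + 1)) := by
  obtain ⟨-, φ, χ, hφ, h0, hφ0, hχ, hg0, hA, hB⟩ := hb
  have hd1 : HasFDerivAt φ (fderiv ℝ φ 0) 0 :=
    ((hφ.1.contDiffAt (φ.open_source.mem_nhds h0)).differentiableAt (by simp)).hasFDerivAt
  have h0t : (0 : ℂ) ∈ φ.target := hφ0 ▸ φ.map_source h0
  have hsymm0 : φ.symm 0 = 0 := by
    have := φ.left_inv h0
    rwa [hφ0] at this
  have hd2 : HasFDerivAt φ.symm (fderiv ℝ φ.symm 0) 0 :=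
    ((hφ.2.contDiffAt (φ.open_target.mem_nhds h0t)).differentiableAt (by simp)).hasFDerivAt
  have hsurj : Function.Surjective (fderiv ℝ φ 0) := by
    have h1 : HasFDerivAt (fun x => φ (φ.symm x)) _ 0 :=
      HasFDerivAt.comp 0 (by rw [hsymm0]; exact hd1) hd2
    have h2 : HasFDerivAt (fun x => φ (φ.symm x)) (ContinuousLinearMap.id ℝ ℂ) 0 := by
      refine (hasFDerivAt_id _).congr_of_eventuallyEq ?_
      filter_upwards [φ.open_target.mem_nhds h0t] with x hx
      exact φ.right_inv hx
    have h3 := h1.unique h2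
    exact fun x => ⟨_, congrArg (fun T : ℂ →L[ℝ] ℂ => T x) h3⟩
  have hφt : Tendsto φ (𝓝 0) (𝓝 0) := by
    have := hd1.continuousAt.tendsto
    rwa [hφ0] at this
  have hφO : (fun z => ‖φ z‖) =O[𝓝 0] fun z => ‖z‖ := by
    have := hd1.isBigO_sub
    simp only [hφ0, sub_zero] at this
    exact this.norm_norm
  have hinv : ∀ᶠ z in 𝓝 (0 : ℂ), φ.symm (φ z) = z := by
    filter_upwards [φ.open_source.mem_nhds h0] with z hz
    exact φ.left_inv hz
  have hA' : (fun z => (χ (g z)).1.1 - φ z ^ (m + 1)) =O[𝓝 0] (fun z => ‖z‖ ^ (m + 2)) := by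
    refine IsBigO.congr' ((hA.comp_tendsto hφt).trans (hφO.pow (m + 2))) ?_ EventuallyEq.rfl
    filter_upwards [hinv] with z hz
    simp [hz]
  have hB' : (fun z => (χ (g z)).1.2) =O[𝓝 0] (fun z => ‖z‖ ^ (m + 2)) := by
    refine IsBigO.congr' ((hB.comp_tendsto hφt).trans (hφO.pow (m + 2))) ?_ EventuallyEq.rfl
    filter_upwards [hinv] with z hz
    simp [hz]
  -- The slice component vanishes because `g` takes values in de Sitter space.
  have hC' : (fun z => (χ (g z)).2) =O[𝓝 0] (fun z => ‖z‖ ^ (m + 1)) := by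
    refine (isBigO_zero _ _).congr' ?_ EventuallyEq.rfl
    filter_upwards [hgS, hgc (χ.open_source.mem_nhds hg0)] with z hz hz'
    exact ((hχ.2 _ hz').1 hz).symm
  have hφm : (fun z => φ z ^ (m + 1)) =O[𝓝 0] (fun z => ‖z‖ ^ (m + 1)) := by
    refine IsBigO.of_norm_left ?_
    simpa using hφO.pow (m + 1)
  have hA'' : (fun z => (χ (g z)).1.1) =O[𝓝 0] (fun z => ‖z‖ ^ (m + 1)) := by
    have := (hA'.trans (pow_norm_isBigO_of_le (Nat.le_succ (m + 1)))).add hφm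
    simpa using this
  have hall : (fun z => χ (g z)) =O[𝓝 0] (fun z => ‖z‖ ^ (m + 1)) :=
    (hA''.prod_left (hB'.trans (pow_norm_isBigO_of_le (Nat.le_succ (m + 1))))).prod_left hC'
  refine ⟨φ, fderiv ℝ φ 0, χ, hφ0, hd1, hsurj, hχ.1, hg0, ?_, hA', hall⟩
  -- At `z = 0` the bound itself is zero, so the target chart is centred at `g 0`.
  obtain ⟨C, hC⟩ := hall.bound
  have := hC.self_of_nhds
  simpa using this

lemma pow_norm_isLittleO (k : ℕ) :
    (fun z : ℂ => ‖z‖ ^ (k + 1)) =o[𝓝 0] fun z : ℂ => ‖z‖ ^ k := by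
  have h1 : (fun z : ℂ => ‖z‖) =o[𝓝 0] fun _ : ℂ => (1 : ℝ) :=
    (isLittleO_one_iff ℝ).2 tendsto_norm_zero
  have h2 := (isBigO_refl (fun z : ℂ => ‖z‖ ^ k) (𝓝 0)).mul_isLittleO h1
  simpa [pow_succ] using h2

/-- Restricting an `o(|z|^k)` function to a ray. -/
lemma tendsto_inv_pow_smul_of_isLittleO {V : Type*} [NormedAddCommGroup V] [NormedSpace ℝ V]
    {f : ℂ → V} {k : ℕ} (hf : f =o[𝓝 0] fun z : ℂ => ‖z‖ ^ k) (η : ℂ) :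
    Tendsto (fun t : ℝ => (t ^ k)⁻¹ • f (t • η)) (𝓝[>] 0) (𝓝 0) := by
  have h1 : Tendsto (fun t : ℝ => t • η) (𝓝[>] 0) (𝓝 0) := by
    have : Continuous fun t : ℝ => t • η := by fun_prop
    simpa using (this.tendsto 0).mono_left (nhdsWithin_le_nhds (s := Ioi 0))
  have h2 := hf.comp_tendsto h1
  have h3 : (fun t : ℝ => ‖t • η‖ ^ k) =O[𝓝[>] 0] fun t : ℝ => t ^ k := by
    refine IsBigO.of_bound (‖η‖ ^ k) (Eventually.of_forall fun t => ?_)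
    simp [mul_pow]
    rw [mul_comm]
  have h4 := h2.trans_isBigO h3
  exact h4.tendsto_inv_smul_nhds_zero

lemma reV_smul_pow_smul (t : ℝ) (η : ℂ) (n : ℕ) (u : Fin 5 → ℂ) :
    reV ((t • η) ^ n • u) = t ^ n • reV (η ^ n • u) := by
  rw [smul_pow, smul_assoc, map_smul]

namespace IsBranchedStationary

variable {g : ℂ → R51} {m : ℕ} (hg : IsBranchedStationary g m)
include hg

lemma exists_chart :
    ∃ (φ : ℂ → ℂ) (Λ : ℂ →L[ℝ] ℂ)
      (χ : OpenPartialHomeomorph R51 ((ℂ × EuclideanSpace ℝ (Fin 2)) × ℝ)),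
      φ 0 = 0 ∧ HasFDerivAt φ Λ 0 ∧ Function.Surjective Λ ∧ IsSmoothChart χ ∧ g 0 ∈ χ.source ∧
      χ (g 0) = 0 ∧
      (fun z => (χ (g z)).1.1 - φ z ^ (m + 1)) =O[𝓝 0] (fun z => ‖z‖ ^ (m + 2)) ∧
      (fun z => χ (g z)) =O[𝓝 0] (fun z => ‖z‖ ^ (m + 1)) := by
  refine hg.branch.exists_chart (hg.differentiableAt zero_mem_disc).continuousAt ?_
  filter_upwards [isOpen_disc.mem_nhds zero_mem_disc] with z hz
  exact hg.mem_deSitter z hz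

lemma sub_isBigO : (fun z => g z - g 0) =O[𝓝 0] fun z => ‖z‖ ^ (m + 1) := by
  obtain ⟨φ, Λ, χ, -, -, -, hχ, hg0, hχ0, -, hO⟩ := hg.exists_chart
  have h0t : (0 : (ℂ × EuclideanSpace ℝ (Fin 2)) × ℝ) ∈ χ.target := hχ0 ▸ χ.map_source hg0
  have hd : DifferentiableAt ℝ χ.symm 0 :=
    (hχ.2.contDiffAt (χ.open_target.mem_nhds h0t)).differentiableAt (by simp)
  have hc : ContinuousAt g 0 := (hg.differentiableAt zero_mem_disc).continuousAt
  have ht : Tendsto (fun z => χ (g z)) (𝓝 0) (𝓝 0) := by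
    have := (χ.continuousAt hg0).comp hc
    rwa [ContinuousAt, Function.comp_apply, hχ0] at this
  have h1 := hd.isBigO_sub.comp_tendsto ht
  simp only [Function.comp_def, sub_zero] at h1
  refine IsBigO.congr' (h1.trans hO) ?_ EventuallyEq.rfl
  filter_upwards [hc (χ.open_source.mem_nhds hg0)] with z hz
  rw [χ.left_inv hz, ← hχ0, χ.left_inv hg0]

/-- For `k < m` the leading term `Re(z ^ (k + 1) q(0)) / (k + 1)` must be `O(|z|^(k+2))`. Along rays
this gives `Re(η ^ (k + 1) q(0)) = 0` for every `η`; the choices `η = 1` and `η ^ (k + 1) = i`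
remove the real and the imaginary part. -/
lemma apply_zero_eq_zero {k : ℕ} {q : Fin 5 → ℂ → ℂ} (hq : IsDerivQuotient g k q)
    (hk : k < m) (i : Fin 5) : q i 0 = 0 := by
  have h1 := hg.sub_leading_isBigO hq
  have h2 := (hg.sub_isBigO.trans (pow_norm_isBigO_of_le (by omega : k + 2 ≤ m + 1))).sub h1
  simp only [sub_sub_cancel] at h2
  have h3 := h2.trans_isLittleO (pow_norm_isLittleO (k + 1))
  have h4 : ∀ η : ℂ, reV (η ^ (k + 1) • fun i => q i 0) = 0 := by
    intro η
    have h5 := tendsto_inv_pow_smul_of_isLittleO h3 η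
    have h6 : Tendsto (fun t : ℝ => (t ^ (k + 1))⁻¹ • (1 / (k + 1 : ℝ)) •
        reV ((t • η) ^ (k + 1) • fun i => q i 0)) (𝓝[>] 0)
        (𝓝 ((1 / (k + 1 : ℝ)) • reV (η ^ (k + 1) • fun i => q i 0))) := by
      refine tendsto_const_nhds.congr' ?_
      filter_upwards [self_mem_nhdsWithin] with t ht
      have ht0 : t ≠ 0 := (mem_Ioi.1 ht).ne'
      rw [reV_smul_pow_smul, smul_comm _ (t ^ (k + 1)), smul_smul (t ^ (k + 1))⁻¹,
        inv_mul_cancel₀ (pow_ne_zero _ ht0), one_smul]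
    have h7 := tendsto_nhds_unique h6 h5
    have h8 : (1 / (k + 1 : ℝ)) ≠ 0 := by positivity
    exact (smul_eq_zero.1 h7).resolve_left h8
  have h5 : (q i 0).re = 0 := by
    have := congrFun (h4 1) i
    simpa using this
  obtain ⟨η, hη⟩ := IsAlgClosed.exists_pow_nat_eq Complex.I (Nat.succ_pos k)
  have h6 : (q i 0).im = 0 := by
    have := congrFun (h4 η) i
    rw [Nat.succ_eq_add_one] at hη
    simpa [hη] using this
  exact Complex.ext h5 h6

lemma exists_isDerivQuotient : ∀ k ≤ m, ∃ q, IsDerivQuotient g k q := by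
  intro k
  induction k with
  | zero => exact fun _ => ⟨_, hg.isDerivQuotient_zero⟩
  | succ k ih =>
    intro hk
    obtain ⟨q, hq⟩ := ih (by omega)
    exact hg.exists_isDerivQuotient_succ hq (hg.apply_zero_eq_zero hq (by omega))

/-- The leading coefficient at the branch point is not a complex multiple of a real vector. -/
lemma leading_not_real {q : Fin 5 → ℂ → ℂ} (hq : IsDerivQuotient g m q) (x : R51) (a b : ℝ)
    (ha : reV (fun i => q i 0) = a • x) (hb : imV (fun i => q i 0) = b • x) : False := by
  obtain ⟨φ, Λ, χ, hφ0, hφ, hΛ, hχ, hg0, hχ0, hA, -⟩ := hg.exists_chart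
  have hd : HasFDerivAt χ (fderiv ℝ χ (g 0)) (g 0) :=
    ((hχ.1.contDiffAt (χ.open_source.mem_nhds hg0)).differentiableAt (by simp)).hasFDerivAt
  set L : R51 →L[ℝ] ℂ := (ContinuousLinearMap.fst ℝ _ _).comp
    ((ContinuousLinearMap.fst ℝ _ _).comp (fderiv ℝ χ (g 0))) with hL
  have hK : HasFDerivAt (fun y => (χ y).1.1) L (g 0) := hd.fst.fst
  have hc : Tendsto g (𝓝 0) (𝓝 (g 0)) := (hg.differentiableAt zero_mem_disc).continuousAt
  have h1 : (fun z => (χ (g z)).1.1 - L (g z - g 0)) =o[𝓝 0] fun z => ‖z‖ ^ (m + 1) := by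
    have := (hK.isLittleO.comp_tendsto hc).trans_isBigO hg.sub_isBigO
    simpa [Function.comp_def, hχ0] using this
  have h2 := (L.isBigO_comp _ (𝓝 0)).trans (hg.sub_leading_isBigO hq)
  have h3 := h2.trans_isLittleO (pow_norm_isLittleO (m + 1))
  have h4 := hA.trans_isLittleO (pow_norm_isLittleO (m + 1))
  have h5 : (fun z => φ z ^ (m + 1) - L ((1 / (m + 1 : ℝ)) • reV (z ^ (m + 1) • fun i => q i 0)))
      =o[𝓝 0] fun z => ‖z‖ ^ (m + 1) := by
    refine ((h1.add h3).sub h4).congr_left fun z => ?_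
    simp only [map_sub]
    ring
  -- Comparing terms of degree `m + 1` along the ray through `η`: the chart component of the leading
  -- term lies on the real line through `L x`.
  have key : ∀ η : ℂ, ∃ s : ℝ, Λ η ^ (m + 1) = s • L x := by
    intro η
    have h6 := tendsto_inv_pow_smul_of_isLittleO h5 η
    have h7 : Tendsto (fun t : ℝ => (t⁻¹ • φ (t • η)) ^ (m + 1)) (𝓝[>] 0)
        (𝓝 (Λ η ^ (m + 1))) := by
      have h8 : HasDerivAt (fun t : ℝ => φ (t • η)) (Λ η) 0 := by
        have h9 : HasDerivAt (fun t : ℝ => t • η) ((1 : ℝ) • η) 0 := (hasDerivAt_id 0).smul_const η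
        rw [one_smul] at h9
        refine HasFDerivAt.comp_hasDerivAt 0 ?_ h9
        simpa using hφ
      have h10 := h8.tendsto_slope_zero_right
      simp only [zero_add, zero_smul, hφ0, sub_zero] at h10
      exact h10.pow (m + 1)
    have h8 : Tendsto (fun t : ℝ => (t⁻¹ • φ (t • η)) ^ (m + 1) -
        L ((1 / (m + 1 : ℝ)) • reV (η ^ (m + 1) • fun i => q i 0))) (𝓝[>] 0) (𝓝 0) := by
      refine h6.congr' ?_
      filter_upwards [self_mem_nhdsWithin] with t ht
      have ht0 : t ≠ 0 := (mem_Ioi.1 ht).ne'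
      rw [reV_smul_pow_smul, smul_comm _ (t ^ (m + 1)), map_smul L (t ^ (m + 1)), smul_sub,
        smul_smul (t ^ (m + 1))⁻¹ (t ^ (m + 1)), inv_mul_cancel₀ (pow_ne_zero _ ht0), one_smul,
        smul_pow, inv_pow]
    have h9 := sub_eq_zero.1 (tendsto_nhds_unique (h7.sub_const _) h8)
    rw [h9, reV_smul, ha, hb, smul_smul, smul_smul, ← sub_smul, smul_smul, map_smul]
    exact ⟨_, rfl⟩
  -- Every complex number is an `(m + 1)`-st power of some `Λ η`, so all of `ℂ` would be one real
  -- line.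
  have key2 : ∀ ξ : ℂ, ∃ s : ℝ, ξ = s • L x := by
    intro ξ
    obtain ⟨y, hy⟩ := IsAlgClosed.exists_pow_nat_eq ξ (Nat.succ_pos m)
    obtain ⟨η, rfl⟩ := hΛ y
    obtain ⟨s, hs⟩ := key η
    exact ⟨s, hy.symm.trans hs⟩
  obtain ⟨s, hs⟩ := key2 1
  obtain ⟨t, ht⟩ := key2 Complex.I
  have e1 := congrArg Complex.re hs
  have e2 := congrArg Complex.im hs
  have e3 := congrArg Complex.re ht
  have e4 := congrArg Complex.im ht
  simp at e1 e2 e3 e4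
  rcases e2 with h | h <;> rcases e3 with h' | h' <;> simp_all

end IsBranchedStationary

/-! ### The tangent frame across the branch point -/

/-- `ψ` is a nowhere degenerate frame of the (extended) tangent planes of `g`: the complex
derivative of `g` is `z ^ m • ψ z`. -/
structure IsTangentFrame (g : ℂ → R51) (m : ℕ) (ψ : ℂ → Fin 5 → ℂ) : Prop where
  smooth : ContDiffOn ℝ ∞ ψ disc
  fderiv_eq : ∀ z ∈ disc, ∀ X, fderiv ℝ g z X = reV ((z ^ m * X) • ψ z)
  re_re_pos : ∀ z ∈ disc, 0 < lorentz (reV (ψ z)) (reV (ψ z))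
  im_im : ∀ z ∈ disc, lorentz (imV (ψ z)) (imV (ψ z)) = lorentz (reV (ψ z)) (reV (ψ z))
  re_im : ∀ z ∈ disc, lorentz (reV (ψ z)) (imV (ψ z)) = 0
  re_perp : ∀ z ∈ disc, lorentz (reV (ψ z)) (g z) = 0
  im_perp : ∀ z ∈ disc, lorentz (imV (ψ z)) (g z) = 0
  dbar : ∀ z ∈ disc, ∃ c : ℂ, fderiv ℝ ψ z Complex.I =
    Complex.I • fderiv ℝ ψ z 1 + c • fun i => (g z i : ℂ)

lemma contDiffOn_reV {ψ : ℂ → Fin 5 → ℂ} (h : ContDiffOn ℝ ∞ ψ disc) :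
    ContDiffOn ℝ ∞ (fun z => reV (ψ z)) disc :=
  reV.contDiff.comp_contDiffOn h

lemma contDiffOn_imV {ψ : ℂ → Fin 5 → ℂ} (h : ContDiffOn ℝ ∞ ψ disc) :
    ContDiffOn ℝ ∞ (fun z => imV (ψ z)) disc :=
  imV.contDiff.comp_contDiffOn h

theorem IsBranchedStationary.exists_isTangentFrame {g : ℂ → R51} {m : ℕ}
    (hg : IsBranchedStationary g m) : ∃ ψ, IsTangentFrame g m ψ := by
  obtain ⟨q, hq⟩ := hg.exists_isDerivQuotient m le_rfl
  set ψ : ℂ → Fin 5 → ℂ := fun z i => q i z with hψ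
  have hs : ContDiffOn ℝ ∞ ψ disc := contDiffOn_pi.2 hq.smooth
  have hfd : ∀ z ∈ disc, ∀ X, fderiv ℝ g z X = reV ((z ^ m * X) • ψ z) := by
    intro z hz X
    rw [fderiv_eq_reV]
    congr 1
    ext i
    simp only [Pi.smul_apply, smul_eq_mul, hψ, hq.complexDeriv_eq i z hz]
    ring
  -- Off the origin the frame vectors are values of the differential of `g`, so conformality gives
  -- all their products; the equalities pass to the origin by continuity.
  have hre : ∀ z ∈ disc, z ≠ 0 → reV (ψ z) = fderiv ℝ g z (z ^ m)⁻¹ := by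
    intro z hz hz0
    rw [hfd z hz, mul_inv_cancel₀ (pow_ne_zero m hz0), one_smul]
  have him : ∀ z ∈ disc, z ≠ 0 → imV (ψ z) = fderiv ℝ g z (-Complex.I * (z ^ m)⁻¹) := by
    intro z hz hz0
    rw [hfd z hz, mul_left_comm, mul_inv_cancel₀ (pow_ne_zero m hz0), reV_smul]
    simp
  have hR := contDiffOn_reV hs
  have hI := contDiffOn_imV hs
  have hRR := (hR.lorentz hR).continuousOn
  have hII := (hI.lorentz hI).continuousOn
  have hRI := (hR.lorentz hI).continuousOn
  have hRg := (hR.lorentz hg.smooth).continuousOn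
  have hIg := (hI.lorentz hg.smooth).continuousOn
  have hval : ∀ z ∈ disc, z ≠ 0 → lorentz (reV (ψ z)) (reV (ψ z)) =
      firstForm g z 1 1 * Complex.normSq (z ^ m)⁻¹ := by
    intro z hz hz0
    rw [hre z hz hz0]
    change firstForm g z _ _ = _
    rw [hg.firstForm_eq hz, Complex.inner, Complex.mul_conj]
    generalize (z ^ m)⁻¹ = Y
    simp
  have hii : ∀ z ∈ disc, z ≠ 0 → lorentz (imV (ψ z)) (imV (ψ z)) =
      lorentz (reV (ψ z)) (reV (ψ z)) := by
    intro z hz hz0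
    rw [hval z hz hz0, him z hz hz0]
    change firstForm g z _ _ = _
    rw [hg.firstForm_eq hz, Complex.inner, Complex.mul_conj]
    generalize (z ^ m)⁻¹ = Y
    simp
  have hri : ∀ z ∈ disc, z ≠ 0 → lorentz (reV (ψ z)) (imV (ψ z)) = 0 := by
    intro z hz hz0
    rw [him z hz hz0, hre z hz hz0]
    change firstForm g z _ _ = _
    rw [hg.firstForm_eq hz, Complex.inner, mul_assoc, Complex.mul_conj]
    generalize (z ^ m)⁻¹ = Y
    simp
  have hrg : ∀ z ∈ disc, z ≠ 0 → lorentz (reV (ψ z)) (g z) = 0 := fun z hz hz0 => by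
    rw [hre z hz hz0, hg.lorentz_fderiv_self hz]
  have hig : ∀ z ∈ disc, z ≠ 0 → lorentz (imV (ψ z)) (g z) = 0 := fun z hz hz0 => by
    rw [him z hz hz0, hg.lorentz_fderiv_self hz]
  have hpos : ∀ z ∈ disc, z ≠ 0 → 0 < lorentz (reV (ψ z)) (reV (ψ z)) := by
    intro z hz hz0
    rw [hval z hz hz0]
    exact mul_pos (hg.firstForm_one_one_pos hz hz0)
      (Complex.normSq_pos.2 (inv_ne_zero (pow_ne_zero m hz0)))
  have hii0 := eq_zero_of_eqOn_ne hII hRR hii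
  have hri0 := eq_zero_of_eqOn_ne hRI continuousOn_const hri
  -- Continuity only gives `≥ 0`. Equality would make the two frame vectors null, orthogonal and
  -- hence proportional, which the branch form forbids.
  have hpos0 : 0 < lorentz (reV (ψ 0)) (reV (ψ 0)) := by
    have hnhds := isOpen_disc.mem_nhds zero_mem_disc
    refine lt_of_le_of_ne ?_ fun h => ?_
    · refine ge_of_tendsto ((hRR.continuousAt hnhds).tendsto.mono_left
        (nhdsWithin_le_nhds (s := {0}ᶜ))) ?_
      filter_upwards [self_mem_nhdsWithin, nhdsWithin_le_nhds hnhds] with z hz hz'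
      exact (hpos z hz' hz).le
    · obtain ⟨x, a, b, ha, hb⟩ := exists_smul_of_null h.symm (hii0.trans h.symm) hri0
      exact hg.leading_not_real hq x a b ha hb
  have hext : ∀ {p : ℂ → Prop}, p 0 → (∀ z ∈ disc, z ≠ 0 → p z) → ∀ z ∈ disc, p z := by
    intro p h0 h z hz
    rcases eq_or_ne z 0 with rfl | hz0
    · exact h0
    · exact h z hz hz0
  refine ⟨ψ, hs, hfd, hext hpos0 hpos, hext hii0 hii, hext hri0 hri,
    hext (eq_zero_of_eqOn_ne hRg continuousOn_const hrg) hrg,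
    hext (eq_zero_of_eqOn_ne hIg continuousOn_const hig) hig, fun z hz => ?_⟩
  -- The system reads `ψ_x + i ψ_y = -σ g` with `σ` the sum below; solving for `ψ_y` gives `c = i
  -- σ`.
  refine ⟨Complex.I * ∑ j, lorentzSign j * (starRingEnd ℂ) (complexDeriv g j z) * q j z, ?_⟩
  have hfi : ∀ X i, fderiv ℝ ψ z X i = fderiv ℝ (q i) z X := by
    intro X i
    have hd : DifferentiableAt ℝ ψ z :=
      (hs.contDiffAt (isOpen_disc.mem_nhds hz)).differentiableAt (by simp)
    rw [(hasFDerivAt_pi'.1 hd.hasFDerivAt i).fderiv]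
    rfl
  ext i
  have h1 := hq.dbar i z hz
  have h2 : ∑ j, dbarCoeff g i j z * q j z = -(g z i : ℂ) *
      ∑ j, lorentzSign j * (starRingEnd ℂ) (complexDeriv g j z) * q j z := by
    rw [Finset.mul_sum]
    refine Finset.sum_congr rfl fun j _ => ?_
    rw [dbarCoeff]
    ring
  rw [h2] at h1
  simp only [Pi.add_apply, Pi.smul_apply, smul_eq_mul, hfi]
  linear_combination (-Complex.I) * h1 + fderiv ℝ (q i) z Complex.I * Complex.I_sq

/-! ### The normal bundle as the zero set of a submersion -/

/-- The complex-linear extension of the Lorentzian inner product in the second argument. -/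
def pairC (w : R51) (u : Fin 5 → ℂ) : ℂ := ⟨lorentz w (reV u), lorentz w (imV u)⟩

lemma pairC_add (w : R51) (u v : Fin 5 → ℂ) : pairC w (u + v) = pairC w u + pairC w v := by
  apply Complex.ext <;> simp [pairC, lorentz_add_right]

lemma pairC_smul (w : R51) (c : ℂ) (u : Fin 5 → ℂ) : pairC w (c • u) = c * pairC w u := by
  apply Complex.ext
  · simp [pairC, reV_smul, lorentz_sub_right, lorentz_smul_right]
  · simp [pairC, imV_smul, lorentz_add_right, lorentz_smul_right]

lemma pairC_ofReal (w x : R51) : pairC w (fun i => (x i : ℂ)) = lorentz w x := by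
  have h1 : reV (fun i => (x i : ℂ)) = x := by ext; simp
  have h2 : imV (fun i => (x i : ℂ)) = 0 := by ext; simp
  apply Complex.ext <;> simp [pairC, h1, h2, lorentz_zero_right]

lemma pairC_eq_zero_iff {w : R51} {u : Fin 5 → ℂ} :
    pairC w u = 0 ↔ lorentz w (reV u) = 0 ∧ lorentz w (imV u) = 0 := by
  rw [Complex.ext_iff]
  rfl

lemma lorentz_reV_smul (w : R51) (c : ℂ) (u : Fin 5 → ℂ) :
    lorentz w (reV (c • u)) = (c * pairC w u).re := by
  rw [← pairC_smul]
  rfl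

/-- The coefficient of the second fundamental form in the frame `ψ`. -/
def frameCoeff (ψ : ℂ → Fin 5 → ℂ) (z : ℂ) (w : R51) : ℂ := pairC w (fderiv ℝ ψ z 1)

/-- The defining functions of the timelike unit normal bundle. -/
def normalEq (g : ℂ → R51) (ψ : ℂ → Fin 5 → ℂ) (p : ℂ × R51) : Fin 4 → ℝ :=
  ![lorentz p.2 p.2 + 1, lorentz p.2 (g p.1), lorentz p.2 (reV (ψ p.1)),
    lorentz p.2 (imV (ψ p.1))]

namespace IsTangentFrame

variable {g : ℂ → R51} {m : ℕ} {ψ : ℂ → Fin 5 → ℂ} (hψ : IsTangentFrame g m ψ)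
include hψ

lemma differentiableAt {z : ℂ} (hz : z ∈ disc) : DifferentiableAt ℝ ψ z :=
  (hψ.smooth.contDiffAt (isOpen_disc.mem_nhds hz)).differentiableAt (by simp)

/-- Modulo multiples of `g` the frame satisfies the Cauchy-Riemann equations, and pairing with `w ⊥
g` discards those multiples. -/
lemma pairC_fderiv {z : ℂ} (hz : z ∈ disc) {w : R51} (hw : lorentz w (g z) = 0) (X : ℂ) :
    pairC w (fderiv ℝ ψ z X) = X * frameCoeff ψ z w := by
  obtain ⟨c, hc⟩ := hψ.dbar z hz
  have hX : fderiv ℝ ψ z X = (X.re : ℂ) • fderiv ℝ ψ z 1 + (X.im : ℂ) • fderiv ℝ ψ z Complex.I := by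
    conv_lhs => rw [show X = X.re • (1 : ℂ) + X.im • Complex.I by simp]
    rw [map_add, map_smul, map_smul]
    ext i
    simp
  rw [hX, hc, pairC_add, pairC_smul, pairC_smul, pairC_add, pairC_smul, pairC_smul, pairC_ofReal,
    hw, frameCoeff]
  rw [Complex.ofReal_zero]
  linear_combination pairC w (fderiv ℝ ψ z 1) * Complex.re_add_im X

lemma mem_span_of_fderiv (z : ℂ) (hz : z ∈ disc) (X : ℂ) :
    fderiv ℝ g z X = (z ^ m * X).re • reV (ψ z) - (z ^ m * X).im • imV (ψ z) := by
  rw [hψ.fderiv_eq z hz, reV_smul]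

lemma perp_tangentPlane_iff (hg : IsBranchedStationary g m) {z : ℂ} (hz : z ∈ disc) (w : R51) :
    (∀ v ∈ tangentPlane g z, lorentz w v = 0) ↔ pairC w (ψ z) = 0 := by
  rcases eq_or_ne z 0 with rfl | hz0
  · have hm : m ≠ 0 := (Nat.one_le_iff_ne_zero.1 hg.branch.1)
    have hninj : ¬ Function.Injective (fderiv ℝ g 0) := by
      intro h
      have : fderiv ℝ g 0 1 = fderiv ℝ g 0 0 := by
        rw [hψ.fderiv_eq 0 hz, hψ.fderiv_eq 0 hz]
        simp [hm]
      exact one_ne_zero (h this)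
    have hnhds := isOpen_disc.mem_nhds zero_mem_disc
    have hcR : Tendsto (fun ζ => reV (ψ ζ)) (𝓝[≠] 0) (𝓝 (reV (ψ 0))) :=
      ((contDiffOn_reV hψ.smooth).continuousOn.continuousAt hnhds).tendsto.mono_left
        nhdsWithin_le_nhds
    have hcI : Tendsto (fun ζ => imV (ψ ζ)) (𝓝[≠] 0) (𝓝 (imV (ψ 0))) :=
      ((contDiffOn_imV hψ.smooth).continuousOn.continuousAt hnhds).tendsto.mono_left
        nhdsWithin_le_nhds
    have hev : ∀ᶠ ζ in 𝓝[≠] (0 : ℂ), ζ ∈ disc ∧ ζ ≠ 0 := by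
      filter_upwards [self_mem_nhdsWithin, nhdsWithin_le_nhds hnhds] with ζ h1 h2
      exact ⟨h2, h1⟩
    rw [tangentPlane, if_neg hninj]
    constructor
    · intro h
      rw [pairC_eq_zero_iff]
      constructor
      · refine h _ ⟨fun ζ => (ζ ^ m)⁻¹, hcR.congr' ?_⟩
        filter_upwards [hev] with ζ hζ
        rw [hψ.fderiv_eq ζ hζ.1, mul_inv_cancel₀ (pow_ne_zero m hζ.2), one_smul]
      · refine h _ ⟨fun ζ => -Complex.I * (ζ ^ m)⁻¹, hcI.congr' ?_⟩
        filter_upwards [hev] with ζ hζ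
        rw [hψ.fderiv_eq ζ hζ.1, mul_left_comm, mul_inv_cancel₀ (pow_ne_zero m hζ.2), reV_smul]
        simp
    · rintro h v ⟨X, hX⟩
      rw [pairC_eq_zero_iff] at h
      have hl : ∀ {f₁ f₂ : ℂ → R51} {v₁ v₂ : R51}, Tendsto f₁ (𝓝[≠] 0) (𝓝 v₁) →
          Tendsto f₂ (𝓝[≠] 0) (𝓝 v₂) →
          Tendsto (fun ζ => lorentz (f₁ ζ) (f₂ ζ)) (𝓝[≠] 0) (𝓝 (lorentz v₁ v₂)) :=
        fun h1 h2 => (continuous_lorentz.tendsto (_, _)).comp (h1.prodMk_nhds h2)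
      have hne : lorentz (reV (ψ 0)) (reV (ψ 0)) ≠ 0 := (hψ.re_re_pos 0 hz).ne'
      -- A tangent vector equals its orthogonal expansion in the frame, whose coefficients converge;
      -- so a limit of tangent vectors lies in the span of the frame at `0`.
      have h1 : Tendsto (fun ζ => (lorentz (fderiv ℝ g ζ (X ζ)) (reV (ψ ζ)) /
          lorentz (reV (ψ ζ)) (reV (ψ ζ))) • reV (ψ ζ) +
          (lorentz (fderiv ℝ g ζ (X ζ)) (imV (ψ ζ)) /
          lorentz (reV (ψ ζ)) (reV (ψ ζ))) • imV (ψ ζ)) (𝓝[≠] 0) _ := (((hl hX hcR).div (hl hcR hcR) hne).smul hcR).add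
        (((hl hX hcI).div (hl hcR hcR) hne).smul hcI)
      have h2 : v = _ := tendsto_nhds_unique_of_eventuallyEq hX h1 (by
        filter_upwards [hev] with ζ hζ
        have hp := (hψ.re_re_pos ζ hζ.1).ne'
        rw [hψ.mem_span_of_fderiv ζ hζ.1]
        simp only [lorentz_sub_left, lorentz_smul_left, hψ.re_im ζ hζ.1, hψ.im_im ζ hζ.1,
          lorentz_comm (imV (ψ ζ)) (reV (ψ ζ))]
        simp only [mul_zero, sub_zero, zero_sub, neg_div, mul_div_assoc, div_self hp, mul_one,
          neg_smul, ← sub_eq_add_neg])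
      rw [h2, lorentz_add_right, lorentz_smul_right, lorentz_smul_right, h.1, h.2]
      ring
  · have hinj := hg.regular z hz hz0
    rw [tangentPlane, if_pos hinj]
    constructor
    · intro h
      have key : ∀ X : ℂ, (X * pairC w (ψ z)).re = 0 := by
        intro X
        have := h _ ⟨(z ^ m)⁻¹ * X, rfl⟩
        rwa [hψ.fderiv_eq z hz, mul_inv_cancel_left₀ (pow_ne_zero m hz0), lorentz_reV_smul] at this
      apply Complex.ext
      · simpa using key 1
      · simpa using key Complex.I
    · rintro h _ ⟨X, rfl⟩
      rw [hψ.fderiv_eq z hz, lorentz_reV_smul, h]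
      simp

lemma mem_timelikeNormalBundle_iff (hg : IsBranchedStationary g m) {z : ℂ} {w : R51} :
    (z, w) ∈ timelikeNormalBundle g ↔ z ∈ disc ∧ lorentz w w = -1 ∧ lorentz w (g z) = 0 ∧
      pairC w (ψ z) = 0 := by
  constructor
  · rintro ⟨h1, h2, h3, h4⟩
    exact ⟨h1, h2, h3, (hψ.perp_tangentPlane_iff hg h1 w).1 h4⟩
  · rintro ⟨h1, h2, h3, h4⟩
    exact ⟨h1, h2, h3, (hψ.perp_tangentPlane_iff hg h1 w).2 h4⟩

lemma mem_iff_normalEq (hg : IsBranchedStationary g m) (p : ℂ × R51)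
    (hp : p ∈ disc ×ˢ (univ : Set R51)) :
    p ∈ timelikeNormalBundle g ↔ normalEq g ψ p = 0 := by
  obtain ⟨z, w⟩ := p
  rw [hψ.mem_timelikeNormalBundle_iff hg, pairC_eq_zero_iff]
  constructor
  · rintro ⟨-, h2, h3, h4, h5⟩
    ext i
    fin_cases i <;> simp [normalEq, *]
  · intro h
    have h0 := congrFun h 0
    have h1 := congrFun h 1
    have h2 := congrFun h 2
    have h3 := congrFun h 3
    simp [normalEq] at h0 h1 h2 h3
    exact ⟨hp.1, by linarith, h1, h2, h3⟩

lemma contDiffOn_normalEq (hg : IsBranchedStationary g m) :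
    ContDiffOn ℝ ∞ (normalEq g ψ) (disc ×ˢ (univ : Set R51)) := by
  have hw : ContDiffOn ℝ ∞ (fun p : ℂ × R51 => p.2) (disc ×ˢ univ) := contDiffOn_snd
  have hc : ∀ {f : ℂ → R51}, ContDiffOn ℝ ∞ f disc →
      ContDiffOn ℝ ∞ (fun p : ℂ × R51 => f p.1) (disc ×ˢ univ) := fun hf =>
    hf.comp contDiffOn_fst fun p hp => hp.1
  refine contDiffOn_pi.2 fun i => ?_
  fin_cases i
  · exact (hw.lorentz hw).add contDiffOn_const
  · exact hw.lorentz (hc hg.smooth)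
  · exact hw.lorentz (hc (contDiffOn_reV hψ.smooth))
  · exact hw.lorentz (hc (contDiffOn_imV hψ.smooth))

lemma fderiv_normalEq (hg : IsBranchedStationary g m) {z : ℂ} (hz : z ∈ disc) (w : R51) (Z : ℂ)
    (W : R51) :
    fderiv ℝ (normalEq g ψ) (z, w) (Z, W) =
      ![2 * lorentz w W, lorentz w (fderiv ℝ g z Z) + lorentz W (g z),
        (pairC w (fderiv ℝ ψ z Z) + pairC W (ψ z)).re,
        (pairC w (fderiv ℝ ψ z Z) + pairC W (ψ z)).im] := by
  have hd : DifferentiableAt ℝ (normalEq g ψ) (z, w) :=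
    ((hψ.contDiffOn_normalEq hg).contDiffAt ((isOpen_disc.prod isOpen_univ).mem_nhds
      ⟨hz, mem_univ w⟩)).differentiableAt (by simp)
  have hw : HasFDerivAt (fun p : ℂ × R51 => p.2) (ContinuousLinearMap.snd ℝ ℂ R51) (z, w) :=
    hasFDerivAt_snd
  have hc : ∀ {f : ℂ → R51} {f' : ℂ →L[ℝ] R51}, HasFDerivAt f f' z →
      HasFDerivAt (fun p : ℂ × R51 => f p.1) (f'.comp (ContinuousLinearMap.fst ℝ ℂ R51)) (z, w) :=
    fun hf => HasFDerivAt.comp (g := _) (z, w) hf hasFDerivAt_fst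
  have hcomp := hasFDerivAt_pi'.1 hd.hasFDerivAt
  have hψd := (hψ.differentiableAt hz).hasFDerivAt
  have h0 := (hcomp 0).unique ((hw.lorentz hw).add_const 1)
  have h1 := (hcomp 1).unique (hw.lorentz (hc (hg.differentiableAt hz).hasFDerivAt))
  have h2 := (hcomp 2).unique (hw.lorentz (hc (reV.hasFDerivAt.comp z hψd)))
  have h3 := (hcomp 3).unique (hw.lorentz (hc (imV.hasFDerivAt.comp z hψd)))
  ext i
  fin_cases i
  · have := congrArg (fun T : ℂ × R51 →L[ℝ] ℝ => T (Z, W)) h0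
    simp [lorentzL_apply, lorentz_comm W] at this
    simp
    linarith
  · have := congrArg (fun T : ℂ × R51 →L[ℝ] ℝ => T (Z, W)) h1
    simpa [lorentzL_apply] using this
  · have := congrArg (fun T : ℂ × R51 →L[ℝ] ℝ => T (Z, W)) h2
    simpa [lorentzL_apply, pairC] using this
  · have := congrArg (fun T : ℂ × R51 →L[ℝ] ℝ => T (Z, W)) h3
    simpa [lorentzL_apply, pairC] using this

/-- These are the equations of the tangent space of the bundle. The term `⟨w, dg Z⟩` is absent
because `w` is normal to the surface. -/
lemma fderiv_normalEq_eq_zero_iff (hg : IsBranchedStationary g m) {z : ℂ} {w : R51}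
    (hp : (z, w) ∈ timelikeNormalBundle g) (Z : ℂ) (W : R51) :
    fderiv ℝ (normalEq g ψ) (z, w) (Z, W) = 0 ↔
      lorentz w W = 0 ∧ lorentz W (g z) = 0 ∧ Z * frameCoeff ψ z w + pairC W (ψ z) = 0 := by
  obtain ⟨hz, -, hwg, hwψ⟩ := (hψ.mem_timelikeNormalBundle_iff hg).1 hp
  have hdg : lorentz w (fderiv ℝ g z Z) = 0 := by
    rw [hψ.fderiv_eq z hz, lorentz_reV_smul, hwψ]
    simp
  rw [hψ.fderiv_normalEq hg hz, hψ.pairC_fderiv hz hwg, hdg]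
  constructor
  · intro h
    have h0 := congrFun h 0
    have h1 := congrFun h 1
    have h2 := congrFun h 2
    have h3 := congrFun h 3
    refine ⟨by simpa using h0, by simpa using h1, Complex.ext h2 h3⟩
  · rintro ⟨h0, h1, h2⟩
    ext i
    fin_cases i <;> simp [h0, h1, h2]

lemma fderiv_normalEq_surjective (hg : IsBranchedStationary g m) {p : ℂ × R51}
    (hp : p ∈ timelikeNormalBundle g) :
    Function.Surjective (fderiv ℝ (normalEq g ψ) p) := by
  obtain ⟨z, w⟩ := p
  obtain ⟨hz, hww, hwg, hwψ⟩ := (hψ.mem_timelikeNormalBundle_iff hg).1 hp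
  obtain ⟨hwR, hwI⟩ := pairC_eq_zero_iff.1 hwψ
  have hgg : lorentz (g z) (g z) = 1 := hg.mem_deSitter z hz
  have hRg := hψ.re_perp z hz
  have hIg := hψ.im_perp z hz
  have hRI := hψ.re_im z hz
  have hII := hψ.im_im z hz
  have hpos := hψ.re_re_pos z hz
  intro y
  set R := reV (ψ z) with hR
  set I := imV (ψ z) with hI
  set c := lorentz R R
  -- Vertical vectors suffice: `w`, `g`, `Re ψ`, `Im ψ` are orthogonal with squares `-1, 1, c, c`,
  -- so each coefficient is read off from one equation.
  refine ⟨(0, (-(y 0 / 2)) • w + y 1 • g z + (y 2 / c) • R + (y 3 / c) • I), ?_⟩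
  rw [hψ.fderiv_normalEq hg hz]
  ext i
  fin_cases i <;>
    simp [pairC, lorentz_zero_right, lorentz_add_right, lorentz_add_left, lorentz_smul_left,
      lorentz_smul_right, lorentz_neg_left, lorentz_neg_right, hww, hwg, hwR, hwI, hgg, hRg, hIg, hRI, hII, lorentz_comm (g z),
      lorentz_comm I R, ← hR, ← hI]
  · ring
  · field_simp
    rfl
  · field_simp

lemma isSubmanifold3 (hg : IsBranchedStationary g m) :
    IsSubmanifold3 (timelikeNormalBundle g) := by
  intro p hp
  exact exists_isSliceChart_of_surjective (isOpen_disc.prod isOpen_univ)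
    (hψ.contDiffOn_normalEq hg) (hψ.mem_iff_normalEq hg) ⟨hp.1, mem_univ _⟩
    (hψ.fderiv_normalEq_surjective hg hp) (by simp)

end IsTangentFrame

/-! ### The second fundamental form of the surface -/

section SecondForm

variable {g : ℂ → R51} {m : ℕ} {ψ : ℂ → Fin 5 → ℂ}

/-- Differentiating `dg Y = Re(z ^ m Y ψ)`, the derivative of `z ^ m` multiplies `ψ`, which pairs to
zero with `w`. -/
lemma IsTangentFrame.secondForm_eq (hψ : IsTangentFrame g m ψ) (hg : IsBranchedStationary g m)
    {z : ℂ} {w : R51} (hp : (z, w) ∈ timelikeNormalBundle g) (X Y : ℂ) :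
    secondForm g z w X Y = (z ^ m * frameCoeff ψ z w * X * Y).re := by
  obtain ⟨hz, -, hwg, hwψ⟩ := (hψ.mem_timelikeNormalBundle_iff hg).1 hp
  have h1 : HasFDerivAt (fun ζ : ℂ => ζ ^ m * Y) _ z :=
    (((hasDerivAt_pow m z).mul_const Y).hasFDerivAt).restrictScalars ℝ
  have h2 := reV.hasFDerivAt.comp z (h1.smul (hψ.differentiableAt hz).hasFDerivAt)
  have h3 : HasFDerivAt (fun ζ => fderiv ℝ g ζ Y) _ z := h2.congr_of_eventuallyEq (by
    filter_upwards [isOpen_disc.mem_nhds hz] with ζ hζ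
    rw [hψ.fderiv_eq ζ hζ]
    rfl)
  have h4 := congrArg (fun T : ℂ →L[ℝ] R51 => T X) ((hg.hasFDerivAt_fderiv_apply hz Y).unique h3)
  simp only [ContinuousLinearMap.flip_apply, ContinuousLinearMap.comp_apply, add_apply,
    smul_apply, map_add, ContinuousLinearMap.smulRight_apply] at h4
  rw [secondForm, lorentz_comm, h4, lorentz_add_right, lorentz_reV_smul, lorentz_reV_smul, hwψ,
    hψ.pairC_fderiv hz hwg]
  rw [mul_zero, Complex.zero_re, add_zero]
  congr 1
  ring

lemma IsTangentFrame.firstForm_one_one (hψ : IsTangentFrame g m ψ) {z : ℂ} (hz : z ∈ disc) :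
    firstForm g z 1 1 = (‖z‖ ^ 2) ^ m * lorentz (reV (ψ z)) (reV (ψ z)) := by
  rw [firstForm, hψ.mem_span_of_fderiv z hz, mul_one]
  simp only [lorentz_sub_left, lorentz_sub_right, lorentz_smul_left, lorentz_smul_right,
    hψ.re_im z hz, hψ.im_im z hz, lorentz_comm (imV (ψ z)) (reV (ψ z))]
  rw [← Complex.normSq_eq_norm_sq, ← map_pow, Complex.normSq_apply]
  ring

/-- The form `Re(h X Y)` with `h = z ^ m H` has determinant `-|h|²`, while the conformal factor is
`|z|^(2m) q`; the weight `|z|^(2m)` cancels every remaining power of `|z|`. -/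
lemma IsTangentFrame.norm_pow_mul_det (hψ : IsTangentFrame g m ψ)
    (hg : IsBranchedStationary g m) {z : ℂ} {w : R51} (hp : (z, w) ∈ timelikeNormalBundle g)
    (hz0 : z ≠ 0) :
    ‖z‖ ^ (2 * m) * LinearMap.det (surfaceShape g z w) =
      -(Complex.normSq (frameCoeff ψ z w) / lorentz (reV (ψ z)) (reV (ψ z)) ^ 2) := by
  have hz := hp.1
  rw [det_surfaceShape w (hg.firstForm_eq hz), hψ.firstForm_one_one hz]
  simp only [hψ.secondForm_eq hg hp]
  have hq := (hψ.re_re_pos z hz).ne'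
  have hn : ‖z‖ ^ 2 ≠ 0 := pow_ne_zero 2 (norm_ne_zero_iff.2 hz0)
  have hh : ∀ h : ℂ, (h * 1 * 1).re * (h * Complex.I * Complex.I).re -
      (h * 1 * Complex.I).re * (h * Complex.I * 1).re = -Complex.normSq h := by
    intro h
    simp [Complex.normSq_apply]
    ring
  rw [hh, map_mul, map_pow, Complex.normSq_eq_norm_sq z, pow_mul]
  have hN : (‖z‖ ^ 2) ^ m ≠ 0 := pow_ne_zero m hn
  field_simp

end SecondForm

/-! ### Regular points of the polar map -/

section RegularPoints

variable {g : ℂ → R51} {m : ℕ} {ψ : ℂ → Fin 5 → ℂ}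

lemma hasFDerivAt_polarIn {N : Set (ℂ × R51)} {e : Chart3} (he : IsSliceChart N e)
    {p : ℂ × R51} (hp : p ∈ N) (hpe : p ∈ e.source) :
    HasFDerivAt (polarIn e) ((ContinuousLinearMap.snd ℝ ℂ R51).comp
      (fderiv ℝ (sliceParam e) (e p).1)) (e p).1 :=
  (((contDiffAt_sliceParam he hp hpe).differentiableAt (by simp)).hasFDerivAt).snd

lemma fderiv_polarIn {N : Set (ℂ × R51)} {e : Chart3} (he : IsSliceChart N e)
    {p : ℂ × R51} (hp : p ∈ N) (hpe : p ∈ e.source) (X : Fin 3 → ℝ) :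
    fderiv ℝ (polarIn e) (e p).1 X = (fderiv ℝ (sliceParam e) (e p).1 X).2 := by
  rw [(hasFDerivAt_polarIn he hp hpe).fderiv]
  rfl

variable (hψ : IsTangentFrame g m ψ) (hg : IsBranchedStationary g m)
  {e : Chart3} (he : IsSliceChart (timelikeNormalBundle g) e) {z : ℂ} {w : R51}
  (hp : (z, w) ∈ timelikeNormalBundle g) (hpe : (z, w) ∈ e.source)
include hψ hg he hp hpe

lemma IsTangentFrame.tangent_eqs (X : Fin 3 → ℝ) :
    lorentz w (fderiv ℝ (polarIn e) (e (z, w)).1 X) = 0 ∧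
    lorentz (fderiv ℝ (polarIn e) (e (z, w)).1 X) (g z) = 0 ∧
    (fderiv ℝ (sliceParam e) (e (z, w)).1 X).1 * frameCoeff ψ z w +
      pairC (fderiv ℝ (polarIn e) (e (z, w)).1 X) (ψ z) = 0 := by
  rw [fderiv_polarIn he hp hpe, ← hψ.fderiv_normalEq_eq_zero_iff hg hp]
  exact fderiv_sliceParam_mem_ker (isOpen_disc.prod isOpen_univ) (hψ.contDiffOn_normalEq hg)
    (hψ.mem_iff_normalEq hg) he hp hpe ⟨hp.1, mem_univ _⟩ X

lemma IsTangentFrame.exists_tangent {Z : ℂ} {W : R51} (h1 : lorentz w W = 0)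
    (h2 : lorentz W (g z) = 0) (h3 : Z * frameCoeff ψ z w + pairC W (ψ z) = 0) :
    ∃ X, fderiv ℝ (sliceParam e) (e (z, w)).1 X = (Z, W) :=
  exists_fderiv_sliceParam_eq (isOpen_disc.prod isOpen_univ) (hψ.contDiffOn_normalEq hg)
    (hψ.mem_iff_normalEq hg) he hp hpe ⟨hp.1, mem_univ _⟩ (hψ.fderiv_normalEq_surjective hg hp)
    (by simp) ((hψ.fderiv_normalEq_eq_zero_iff hg hp Z W).2 ⟨h1, h2, h3⟩)

/-- The kernel of the projection `(Z, W) ↦ W` consists of the `(Z, 0)` with `Z H = 0`. The criterion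
does not involve the chart. -/
lemma IsTangentFrame.injective_fderiv_polarIn_iff :
    Function.Injective (fderiv ℝ (polarIn e) (e (z, w)).1) ↔ frameCoeff ψ z w ≠ 0 := by
  have hinj := (injective_iff_map_eq_zero _).1 (fderiv_sliceParam_injective he hp hpe)
  rw [injective_iff_map_eq_zero]
  constructor
  · intro h h0
    obtain ⟨X, hX⟩ := hψ.exists_tangent hg he hp hpe (Z := 1) (W := 0) (lorentz_zero_right w)
      (lorentz_zero_left _) (by
        rw [h0, mul_zero, zero_add, pairC_eq_zero_iff]
        exact ⟨lorentz_zero_left _, lorentz_zero_left _⟩)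
    have hX0 : X = 0 := h X (by rw [fderiv_polarIn he hp hpe, hX])
    rw [hX0, map_zero] at hX
    exact one_ne_zero (congrArg Prod.fst hX).symm
  · intro h X hX
    obtain ⟨-, -, h3⟩ := hψ.tangent_eqs hg he hp hpe X
    have h4 : pairC 0 (ψ z) = 0 :=
      pairC_eq_zero_iff.2 ⟨lorentz_zero_left _, lorentz_zero_left _⟩
    rw [hX, h4, add_zero] at h3
    rw [fderiv_polarIn he hp hpe] at hX
    exact hinj X (Prod.ext ((mul_eq_zero.1 h3).resolve_right h) hX)

omit he hpe in
lemma IsTangentFrame.isRegularPoint_iff :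
    IsRegularPoint (timelikeNormalBundle g) (z, w) ↔ frameCoeff ψ z w ≠ 0 := by
  constructor
  · rintro ⟨-, e, he, hpe, h⟩
    exact (hψ.injective_fderiv_polarIn_iff hg he hp hpe).1 h
  · intro h
    obtain ⟨e, he, hpe⟩ := hψ.isSubmanifold3 hg (z, w) hp
    exact ⟨hp, e, he, hpe, (hψ.injective_fderiv_polarIn_iff hg he hp hpe).2 h⟩

omit he hp hpe in
/-- Points of the normal bundle over the branch point are limits of points off it. -/
lemma IsTangentFrame.nhdsWithin_neBot (hp : ((0 : ℂ), w) ∈ timelikeNormalBundle g) :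
    (𝓝[{p | p ∈ timelikeNormalBundle g ∧ p.1 ≠ 0}] ((0 : ℂ), w)).NeBot := by
  rw [← mem_closure_iff_nhdsWithin_neBot, mem_closure_iff_frequently]
  obtain ⟨e, he, hpe⟩ := hψ.isSubmanifold3 hg (0, w) hp
  have hc : Tendsto (sliceParam e) (𝓝 (e (0, w)).1) (𝓝 (0, w)) := by
    have := (contDiffAt_sliceParam he hp hpe).continuousAt.tendsto
    rwa [sliceParam_apply_fst he hp hpe] at this
  refine hc.frequently ?_
  intro hcon
  have hz : ∀ᶠ a in 𝓝 (e (0, w)).1, (sliceParam e a).1 = 0 := by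
    filter_upwards [hcon, eventually_sliceParam_mem he hp hpe] with a h1 h2
    by_contra h
    exact h1 ⟨h2, h⟩
  have hd := (((contDiffAt_sliceParam he hp hpe).differentiableAt (by simp)).hasFDerivAt).fst
  have hd0 := hd.unique ((hasFDerivAt_const (0 : ℂ) _).congr_of_eventuallyEq hz)
  obtain ⟨h0, -, -, hwψ⟩ := (hψ.mem_timelikeNormalBundle_iff hg).1 hp
  obtain ⟨hwR, hwI⟩ := pairC_eq_zero_iff.1 hwψ
  set H := frameCoeff ψ 0 w with hH
  set q := lorentz (reV (ψ 0)) (reV (ψ 0)) with hq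
  have hq0 : q ≠ 0 := (hψ.re_re_pos 0 h0).ne'
  -- If the bundle near this point lay over `z = 0`, every tangent vector would have `Z = 0`. The
  -- chosen `W` satisfies `⟨W, ψ⟩ = -H`, which makes `(1, W)` tangent.
  obtain ⟨X, hX⟩ := hψ.exists_tangent hg he hp hpe (Z := 1)
    (W := (-(H.re / q)) • reV (ψ 0) - (H.im / q) • imV (ψ 0))
    (by rw [lorentz_sub_right, lorentz_smul_right, lorentz_smul_right, hwR, hwI]; ring)
    (by rw [lorentz_sub_left, lorentz_smul_left, lorentz_smul_left, hψ.re_perp 0 h0,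
          hψ.im_perp 0 h0]; ring)
    (by
      apply Complex.ext
      · simp only [pairC, lorentz_sub_left, lorentz_smul_left, hψ.re_im 0 h0, ← hq, ← hH,
          lorentz_comm (imV (ψ 0)) (reV (ψ 0)), one_mul, Complex.add_re, Complex.zero_re]
        field_simp
        ring
      · simp only [pairC, lorentz_sub_left, lorentz_smul_left, hψ.re_im 0 h0, ← hq, ← hH,
          hψ.im_im 0 h0, one_mul, Complex.add_im, Complex.zero_im]
        field_simp
        ring)
  have := congrArg (fun T : (Fin 3 → ℝ) →L[ℝ] ℂ => T X) hd0
  simp [hX] at this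

omit he hpe in
lemma IsTangentFrame.tendsto_det_iff (hz : z = 0) :
    (∃ l : ℝ, l < 0 ∧
      Tendsto (fun p : ℂ × R51 => ‖p.1‖ ^ (2 * m) * LinearMap.det (surfaceShape g p.1 p.2))
        (𝓝[{p | p ∈ timelikeNormalBundle g ∧ p.1 ≠ 0}] (z, w)) (𝓝 l)) ↔
      frameCoeff ψ z w ≠ 0 := by
  subst hz
  have h0 := hp.1
  have hmem := (isOpen_disc.prod (isOpen_univ (X := R51))).mem_nhds
    (x := ((0 : ℂ), w)) ⟨h0, mem_univ _⟩
  have hq0 := (hψ.re_re_pos 0 h0)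
  -- The weighted determinant agrees off the branch point with this function, continuous at `(0,
  -- w)`. So the limit always exists and is nonpositive; only its being nonzero is at stake. Its
  -- uniqueness needs `nhdsWithin_neBot`.
  set u : ℂ × R51 → ℝ := fun p => -(Complex.normSq (frameCoeff ψ p.1 p.2) /
    lorentz (reV (ψ p.1)) (reV (ψ p.1)) ^ 2) with hu
  have hcont : ContinuousAt u (0, w) := by
    have hR : ContinuousAt (fun p : ℂ × R51 => reV (ψ p.1)) (0, w) :=
      ContinuousAt.comp (f := Prod.fst) ((contDiffOn_reV hψ.smooth).continuousOn.continuousAt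
        (isOpen_disc.mem_nhds h0)) continuousAt_fst
    have hdψ : ContinuousAt (fun p : ℂ × R51 => fderiv ℝ ψ p.1 1) (0, w) :=
      ContinuousAt.comp (g := fun z => fderiv ℝ ψ z 1) (f := Prod.fst)
        (((hψ.smooth.continuousOn_fderiv_of_isOpen isOpen_disc (by simp)).clm_apply
          continuousOn_const).continuousAt (isOpen_disc.mem_nhds h0)) continuousAt_fst
    have hl : ∀ {f₁ f₂ : ℂ × R51 → R51}, ContinuousAt f₁ (0, w) → ContinuousAt f₂ (0, w) →
        ContinuousAt (fun p => lorentz (f₁ p) (f₂ p)) (0, w) := fun h1 h2 =>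
      ContinuousAt.comp (g := fun p : R51 × R51 => lorentz p.1 p.2)
        continuous_lorentz.continuousAt (h1.prodMk h2)
    have h1 := hl continuousAt_snd (reV.continuous.continuousAt.comp hdψ)
    have h2 := hl continuousAt_snd (imV.continuous.continuousAt.comp hdψ)
    have h3 : ContinuousAt (fun p : ℂ × R51 => Complex.normSq (frameCoeff ψ p.1 p.2)) (0, w) := by
      simp only [Complex.normSq_apply]
      exact (h1.mul h1).add (h2.mul h2)
    exact (h3.div ((hl hR hR).pow 2) (pow_ne_zero 2 hq0.ne')).neg
  have htend : Tendsto (fun p : ℂ × R51 => ‖p.1‖ ^ (2 * m) *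
      LinearMap.det (surfaceShape g p.1 p.2))
      (𝓝[{p | p ∈ timelikeNormalBundle g ∧ p.1 ≠ 0}] (0, w)) (𝓝 (u (0, w))) := by
    refine (hcont.tendsto.mono_left nhdsWithin_le_nhds).congr' ?_
    filter_upwards [self_mem_nhdsWithin] with p hp'
    exact (hψ.norm_pow_mul_det hg hp'.1 hp'.2).symm
  have hneg : u (0, w) < 0 ↔ frameCoeff ψ 0 w ≠ 0 := by
    rw [hu]
    simp only [neg_lt_zero]
    rw [div_pos_iff_of_pos_right (pow_pos hq0 2), Complex.normSq_pos]
  have := hψ.nhdsWithin_neBot hg hp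
  constructor
  · rintro ⟨l, hl, hlt⟩
    rw [← hneg, ← tendsto_nhds_unique hlt htend]
    exact hl
  · intro h
    exact ⟨_, hneg.2 h, htend⟩

end RegularPoints

/-! ### Curvature of the polar hypersurface -/

section Curvature

open Matrix

/-- `S` is the real part of `(u + i v)` times the square of the form `p + i s`. Its trace relative
to `G` vanishes because the dual vectors `α`, `β` are orthogonal of equal length; its determinant
vanishes because two covectors give rank at most two. -/
lemma matrix_trace_det_eq_zero {G S : Matrix (Fin 3) (Fin 3) ℝ} (hG : IsUnit G.det)
    {α β p s : Fin 3 → ℝ} (hp : G *ᵥ α = p) (hs : G *ᵥ β = s) (h1 : α ⬝ᵥ p = β ⬝ᵥ s)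
    (h2 : α ⬝ᵥ s = 0) (h3 : β ⬝ᵥ p = 0) {u v : ℝ}
    (hS : ∀ i j, S i j = u * (p i * p j - s i * s j) - v * (p i * s j + s i * p j)) :
    (G⁻¹ * S).trace = 0 ∧ (G⁻¹ * S).det = 0 := by
  constructor
  · have hS' : S = u • (vecMulVec p p - vecMulVec s s) -
        v • (vecMulVec p s + vecMulVec s p) := by
      ext i j
      simp [hS, vecMulVec_apply, mul_add]
    have hGp : G⁻¹ *ᵥ p = α := by rw [← hp, mulVec_mulVec, nonsing_inv_mul _ hG, one_mulVec]
    have hGs : G⁻¹ *ᵥ s = β := by rw [← hs, mulVec_mulVec, nonsing_inv_mul _ hG, one_mulVec]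
    have htr : ∀ x y : Fin 3 → ℝ, (G⁻¹ * vecMulVec x y).trace = (G⁻¹ *ᵥ x) ⬝ᵥ y := by
      intro x y
      rw [mul_vecMulVec, trace_vecMulVec]
    rw [hS', mul_sub, Matrix.mul_smul, Matrix.mul_smul, mul_sub, mul_add, trace_sub, trace_smul, trace_smul,
      trace_sub, trace_add, htr, htr, htr, htr, hGp, hGs, h1, h2, h3]
    simp
  · rw [det_mul]
    have : S.det = 0 := by
      rw [det_fin_three]
      simp only [hS]
      ring
    rw [this, mul_zero]

lemma clm_eq_sum (L : (Fin 3 → ℝ) →L[ℝ] R51) (x : Fin 3 → ℝ) :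
    L x = ∑ i, x i • L (Pi.basisFun ℝ (Fin 3) i) := by
  conv_lhs => rw [← (Pi.basisFun ℝ (Fin 3)).sum_repr x]
  simp

variable {g : ℂ → R51} {m : ℕ} {ψ : ℂ → Fin 5 → ℂ}

/-- Differentiating `⟨dΨ Y, g⟩ = 0` in the direction `X` turns the second derivative into `-⟨dΨ Y,
dg Z⟩`, and the tangency equation gives `Z = -⟨dΨ X, ψ⟩ / H`. -/
lemma IsTangentFrame.secondForm_polarIn (hψ : IsTangentFrame g m ψ)
    (hg : IsBranchedStationary g m) {e : Chart3} (he : IsSliceChart (timelikeNormalBundle g) e)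
    {z : ℂ} {w : R51} (hp : (z, w) ∈ timelikeNormalBundle g) (hpe : (z, w) ∈ e.source)
    (hH : frameCoeff ψ z w ≠ 0) (X Y : Fin 3 → ℝ) :
    secondForm (polarIn e) (e (z, w)).1 (g z) X Y = (z ^ m / frameCoeff ψ z w *
      (pairC (fderiv ℝ (polarIn e) (e (z, w)).1 X) (ψ z) *
        pairC (fderiv ℝ (polarIn e) (e (z, w)).1 Y) (ψ z))).re := by
  set a := (e (z, w)).1 with ha
  have hz := hp.1
  have hσ := contDiffAt_sliceParam he hp hpe
  have hσa : sliceParam e a = (z, w) := sliceParam_apply_fst he hp hpe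
  have hf : ContDiffAt ℝ ∞ (polarIn e) a := contDiffAt_snd.comp a hσ
  have hdf : DifferentiableAt ℝ (fderiv ℝ (polarIn e)) a :=
    (hf.fderiv_right (m := ∞) (by simp)).differentiableAt (by simp)
  have h1 : HasFDerivAt (fun b => fderiv ℝ (polarIn e) b Y)
      ((fderiv ℝ (fderiv ℝ (polarIn e)) a).flip Y) a :=
    ((ContinuousLinearMap.apply ℝ R51 Y).hasFDerivAt (x := fderiv ℝ (polarIn e) a)).comp a
      hdf.hasFDerivAt
  have h2 : HasFDerivAt (fun b => (sliceParam e b).1) _ a :=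
    ((hσ.differentiableAt (by simp)).hasFDerivAt).fst
  have h3 : HasFDerivAt (fun b => g (sliceParam e b).1) _ a :=
    HasFDerivAt.comp a (by rw [hσa]; exact (hg.differentiableAt hz).hasFDerivAt) h2
  have h4 : HasFDerivAt (fun b => lorentz (fderiv ℝ (polarIn e) b Y) (g (sliceParam e b).1))
      (0 : (Fin 3 → ℝ) →L[ℝ] ℝ) a := by
    refine (hasFDerivAt_const (0 : ℝ) a).congr_of_eventuallyEq ?_
    filter_upwards [eventually_mem_target he hp hpe, eventually_sliceParam_mem he hp hpe]
      with b hb hb'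
    have hbs : sliceParam e b ∈ e.source := e.map_target hb
    have hbe : (e (sliceParam e b)).1 = b := by rw [sliceParam, e.right_inv hb]
    have := (hψ.tangent_eqs hg he (z := (sliceParam e b).1) (w := (sliceParam e b).2)
      hb' hbs Y).2.1
    rwa [Prod.mk.eta, hbe] at this
  have h5 := congrArg (fun T : (Fin 3 → ℝ) →L[ℝ] ℝ => T X) ((h1.lorentz h3).unique h4)
  simp only [_root_.add_apply, ContinuousLinearMap.comp_apply, lorentzL_apply,
    ContinuousLinearMap.flip_apply, _root_.zero_apply, hσa, ContinuousLinearMap.coe_fst'] at h5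
  have h6 := (hψ.tangent_eqs hg he hp hpe X).2.2
  rw [← ha] at h6
  rw [hψ.fderiv_eq z hz, lorentz_reV_smul] at h5
  rw [secondForm]
  have h7 : (z ^ m / frameCoeff ψ z w * (pairC (fderiv ℝ (polarIn e) a X) (ψ z) *
      pairC (fderiv ℝ (polarIn e) a Y) (ψ z))) =
      -(z ^ m * (fderiv ℝ (sliceParam e) a X).1 * pairC (fderiv ℝ (polarIn e) a Y) (ψ z)) := by
    rw [eq_neg_of_add_eq_zero_right h6]
    field_simp
  rw [h7, Complex.neg_re]
  exact eq_neg_of_add_eq_zero_right h5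

theorem IsTangentFrame.isMinimalZeroGKAt (hψ : IsTangentFrame g m ψ)
    (hg : IsBranchedStationary g m) {e : Chart3} (he : IsSliceChart (timelikeNormalBundle g) e)
    {z : ℂ} {w : R51} (hp : (z, w) ∈ timelikeNormalBundle g) (hpe : (z, w) ∈ e.source)
    (hH : frameCoeff ψ z w ≠ 0) : IsMinimalZeroGKAt (polarIn e) (e (z, w)).1 := by
  obtain ⟨hz, hww, hwg, hwψ⟩ := (hψ.mem_timelikeNormalBundle_iff hg).1 hp
  obtain ⟨hwR, hwI⟩ := pairC_eq_zero_iff.1 hwψ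
  have hgg : lorentz (g z) (g z) = 1 := hg.mem_deSitter z hz
  have htan := hψ.tangent_eqs hg he hp hpe
  have hinj := (injective_iff_map_eq_zero _).1
    ((hψ.injective_fderiv_polarIn_iff hg he hp hpe).2 hH)
  have hII := hψ.secondForm_polarIn hg he hp hpe hH
  have hfa : polarIn e (e (z, w)).1 = w := by
    rw [polarIn, sliceParam_apply_fst he hp hpe]
    rfl
  -- Since `H ≠ 0`, the tangency equation can be solved for `Z`, so only the conditions `W ⊥ w, g`
  -- restrict the image.
  have hsurj : ∀ W, lorentz w W = 0 → lorentz W (g z) = 0 →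
      ∃ X, fderiv ℝ (polarIn e) (e (z, w)).1 X = W := by
    intro W h1 h2
    obtain ⟨X, hX⟩ := hψ.exists_tangent hg he hp hpe (Z := -(pairC W (ψ z)) / frameCoeff ψ z w)
      h1 h2 (by field_simp; ring)
    exact ⟨X, by rw [fderiv_polarIn he hp hpe, hX]⟩
  set a := (e (z, w)).1
  set D := fderiv ℝ (polarIn e) a with hD
  have hpos : ∀ X, X ≠ 0 → 0 < lorentz (D X) (D X) := fun X hX =>
    lorentz_self_pos_of_timelike (by rw [hww]; norm_num) (htan X).1 fun h => hX (hinj X h)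
  refine ⟨hpos, ⟨g z, hgg, by rw [hfa, lorentz_comm, hwg], fun X => ?_⟩, ?_⟩
  · rw [lorentz_comm]
    exact (htan X).2.1
  rintro ν ⟨-, hνf, hνD⟩
  rw [hfa] at hνf
  set c := lorentz ν (g z) with hc
  -- The difference `ν - c g` is orthogonal to `w` and `g`, hence tangent to the hypersurface; being
  -- also normal to it, it is zero by positivity.
  have hν : ν = c • g z := by
    obtain ⟨X, hX⟩ := hsurj (ν - c • g z)
      (by rw [lorentz_sub_right, lorentz_smul_right, hwg, lorentz_comm, hνf]; ring)
      (by rw [lorentz_sub_left, lorentz_smul_left, hgg, ← hc]; ring)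
    have h1 : lorentz (D X) (D X) = 0 := by
      conv_lhs => rw [hX, lorentz_sub_left, ← hX]
      rw [hνD X, lorentz_smul_left, lorentz_comm, (htan X).2.1]
      ring
    have hX0 : X = 0 := by
      by_contra h
      exact (hpos X h).ne' h1
    rw [hX0, map_zero] at hX
    exact (sub_eq_zero.1 hX.symm)
  -- The frame vectors are tangent to the polar hypersurface; their preimages are dual to the
  -- covectors `⟨·, Re ψ⟩` and `⟨·, Im ψ⟩`.
  obtain ⟨α, hα⟩ := hsurj _ hwR (hψ.re_perp z hz)
  obtain ⟨β, hβ⟩ := hsurj _ hwI (hψ.im_perp z hz)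
  set G : Matrix (Fin 3) (Fin 3) ℝ := Matrix.of fun i j =>
    firstForm (polarIn e) a (Pi.basisFun ℝ (Fin 3) i) (Pi.basisFun ℝ (Fin 3) j) with hGdef
  have hGv : ∀ x i, (G *ᵥ x) i = lorentz (D (Pi.basisFun ℝ (Fin 3) i)) (D x) := by
    intro x i
    rw [clm_eq_sum D x, lorentz_sum_right]
    simp only [mulVec, dotProduct, hGdef, Matrix.of_apply, firstForm, lorentz_smul_right]
    exact Finset.sum_congr rfl fun j _ => mul_comm _ _
  have hdot : ∀ x y, x ⬝ᵥ (G *ᵥ y) = lorentz (D x) (D y) := by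
    intro x y
    rw [lorentz_comm, clm_eq_sum D x, lorentz_sum_right]
    simp only [dotProduct, hGv, lorentz_comm (D y), lorentz_smul_left]
  have hG : IsUnit G.det := by
    rw [isUnit_iff_ne_zero]
    intro h
    obtain ⟨x, hx0, hx⟩ := Matrix.exists_mulVec_eq_zero_iff.2 h
    have := hpos x hx0
    rw [← hdot, hx, dotProduct_zero] at this
    exact lt_irrefl _ this
  rw [trace_shapeOperator, det_shapeOperator, ← hGdef]
  refine matrix_trace_det_eq_zero hG (α := α) (β := β) (p := G *ᵥ α) (s := G *ᵥ β)
    (u := c * (z ^ m / frameCoeff ψ z w).re) (v := c * (z ^ m / frameCoeff ψ z w).im) rfl rfl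
    ?_ ?_ ?_ fun i j => ?_
  · rw [hdot, hdot, hα, hβ, hψ.im_im z hz]
  · rw [hdot, hα, hβ, hψ.re_im z hz]
  · rw [hdot, hα, hβ, lorentz_comm, hψ.re_im z hz]
  · have hsec : ∀ X Y, secondForm (polarIn e) a ν X Y =
        c * secondForm (polarIn e) a (g z) X Y := by
      intro X Y
      conv_lhs => rw [hν]
      rw [secondForm, secondForm, lorentz_smul_right]
    rw [Matrix.of_apply, hsec, hII]
    simp only [hGv, hα, hβ, pairC, Complex.mul_re, Complex.mul_im]
    ring

end Curvature

lemma mem_hyperbolic_or {w : R51} (hw : lorentz w w = -1) :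
    (0 < w 0 → w ∈ hyperbolic) ∧ (¬ 0 < w 0 → -w ∈ hyperbolic) := by
  refine ⟨fun h => ⟨hw, h⟩, fun h => ⟨?_, ?_⟩⟩
  · rw [lorentz_neg_left, lorentz_neg_right, neg_neg, hw]
  · rcases lt_or_eq_of_le (not_lt.1 h) with h1 | h1
    · simpa using h1
    · have := lorentz_self_nonneg_of_zero h1
      rw [hw] at this
      norm_num at this

end DeSitterPolar

end

open DeSitterPolar in
theorem proposition4p7 (g : ℂ → R51) (m : ℕ) (hg : IsBranchedStationary g m) :
    IsSubmanifold3 (timelikeNormalBundle g) ∧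
    (∀ p ∈ timelikeNormalBundle g,
      (0 < p.2 0 → polarMap p ∈ hyperbolic) ∧ (¬ 0 < p.2 0 → -polarMap p ∈ hyperbolic)) ∧
    (∀ z w, (z, w) ∈ timelikeNormalBundle g → z ≠ 0 →
      (IsRegularPoint (timelikeNormalBundle g) (z, w) ↔
        LinearMap.det (surfaceShape g z w) ≠ 0)) ∧
    (∀ w, (0, w) ∈ timelikeNormalBundle g →
      (IsRegularPoint (timelikeNormalBundle g) (0, w) ↔
        ∃ l : ℝ, l < 0 ∧
          Tendsto (fun p : ℂ × R51 => ‖p.1‖ ^ (2 * m) * LinearMap.det (surfaceShape g p.1 p.2))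
            (𝓝[{p | p ∈ timelikeNormalBundle g ∧ p.1 ≠ 0}] (0, w)) (𝓝 l))) ∧
    (∀ e : Chart3, IsSliceChart (timelikeNormalBundle g) e →
      ∀ p ∈ timelikeNormalBundle g, p ∈ e.source →
        IsRegularPoint (timelikeNormalBundle g) p →
        IsMinimalZeroGKAt (polarIn e) (e p).1) := by
  obtain ⟨ψ, hψ⟩ := hg.exists_isTangentFrame
  refine ⟨hψ.isSubmanifold3 hg, fun p hp => mem_hyperbolic_or hp.2.1, fun z w hp hz0 => ?_,
    fun w hp => ?_, ?_⟩
  · rw [hψ.isRegularPoint_iff hg hp]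
    have h1 := hψ.norm_pow_mul_det hg hp hz0
    have hq := (hψ.re_re_pos z hp.1).ne'
    have hn : ‖z‖ ^ (2 * m) ≠ 0 := pow_ne_zero _ (norm_ne_zero_iff.2 hz0)
    refine not_congr ⟨fun h => ?_, fun h => ?_⟩
    · rw [h, map_zero, zero_div, neg_zero] at h1
      exact (mul_eq_zero.1 h1).resolve_left hn
    · rw [h, mul_zero, eq_comm, neg_eq_zero, div_eq_zero_iff] at h1
      exact Complex.normSq_eq_zero.1 (h1.resolve_right (pow_ne_zero 2 hq))
  · rw [hψ.isRegularPoint_iff hg hp, hψ.tendsto_det_iff hg hp rfl]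
  · rintro e he ⟨z, w⟩ hp hpe hreg
    exact hψ.isMinimalZeroGKAt hg he hp hpe ((hψ.isRegularPoint_iff hg hp).1 hreg)
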